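/- **Setting.** Let $L>0$, $\Lambda=L\mathbb Z$, and let $0\le x_1^{\mathsf L}<x_1^{\mathsf R}\le x_2^{\mathsf L}<\dots<x_N^{\mathsf R}\le L$ be the end points of $N$ resonators in the unit cell $Y=[0,L]$. Put $D_i=(x_i^{\mathsf L},x_i^{\mathsf R})+\Lambda$ and $D=\bigcup_i D_i$. Given positive constants $\rho_0,\rho_1,\kappa_0,\kappa_1,\dots,\kappa_N$, let $\rho=\rho_1$ in $D$ and $\rho=\rho_0$ in $\mathbb R\setminus D$, and let $\kappa=\kappa_i$ in $D_i$ and $\kappa=\kappa_0$ in $\mathbb R\setminus D$. The one-dimensional Helmholtz operator is $\mathcal L u=-\kappa\,\bigl(\tfrac1\rho u'\bigr)'$. For $\alpha,\beta\in\mathbb R$, let $\mathcal L(\alpha,\beta)$ be the restriction of $\mathcal L$ to functions with complex quasimomentum $\alpha+\mathrm i\beta$, that is, the unbounded operator on $L^2(Y;\mathbb C)$ whose domain consists of (the restrictions to $Y$ of) those $u$ on $\mathbb R$ with $u,\ \tfrac1\rho u'\in H^1_{\mathrm{loc}}(\mathbb R)$ and $u(x+\ell)=e^{\mathrm i(\alpha+\mathrm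 i\beta)\ell}u(x)$ for all $\ell\in\Lambda$. Write $\sigma(\mathcal L(\alpha,\beta))\subset\mathbb C$ for its spectrum, and let $Y^*=(-\pi/L,\pi/L]$ represent the real Brillouin zone $\mathbb R/\tfrac{2\pi}{L}\mathbb Z$. Define $$\sigma(\mathcal L)=\bigcup_{\alpha\in Y^*}\sigma\bigl(\mathcal L(\alpha,0)\bigr),\qquad \rho(\mathcal L)=\mathbb R\setminus\sigma(\mathcal L).$$ The *band gaps* are the connected components of $\rho(\mathcal L)$. The *complex band structure* is the set $$\mathcal C=\bigl\{(\alpha,\beta,\lambda)\in Y^*\times(0,\infty)\times\mathbb R : \lambda\in\sigma(\mathcal L(\alpha,\beta))\bigr\}\subset\mathbb R^3,$$ and the *complex bands* are its connected components. **Theorem.** 1. The resolvent set is parametrised by $$\rho(\mathcal L)=\bigcup_{(\alpha,\beta)\in\tilde{\mathcal B}}\sigma\bigl(\mathcal L(\alpha,\beta)\bigr)\cap\mathbb R,\qquad \tilde{\mathcal B}=\bigl\{-\tfrac{\pi}{L},0,\tfrac{\pi}{L}\bigr\}\times(\mathbb R\setminus\{0\}).$$ 2. The map $(\alpha,\beta,\lambda)\mapsto\lambda$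 is a bijection from $\mathcal C$ onto $\rho(\mathcal L)$. 3. Complex bands and band gaps are in one-to-one correspondence: taking the image under $(\alpha,\beta,\lambda)\mapsto\lambda$ defines a bijection from the set of complex bands onto the set of band gaps. -/

import Mathlib

open MeasureTheory Set

/-- A number `z` lies in the resolvent set of the (unbounded) operator `A` when `A - z` maps the
domain of `A` bijectively onto the whole space and the inverse `R` is bounded; the spectrum is the
complement. -/
def unboundedSpectrum {H : Type*} [NormedAddCommGroup H] [NormedSpace ℂ H] (A : H →ₗ.[ℂ] H) :
    Set ℂ :=
  {z | ¬ ∃ R : H →L[ℂ] H,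
    (∀ f : H, ∃ w : A.domain, (w : H) = R f ∧ A w - z • (w : H) = f) ∧
    (∀ w : A.domain, R (A w - z • (w : H)) = w)}

/-- `u` is locally absolutely continuous on `ℝ` with weak (equivalently, almost everywhere)
derivative `v`. -/
def IsWeakDeriv (u v : ℝ → ℂ) : Prop :=
  LocallyIntegrable v volume ∧ ∀ a b : ℝ, u b - u a = ∫ x in a..b, v x

/-- The set of connected components of a set `S`. -/
def componentsOf {X : Type*} [TopologicalSpace X] (S : Set X) : Set (Set X) :=
  {K | ∃ x ∈ S, K = connectedComponentIn S x}

/-- An infinite one-dimensional resonator chain, `L`-periodic, with `N` resonators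
`(xL i, xR i)` in the unit cell `[0, L]`, density `ρ₁` in all the resonators, bulk modulus `κ i` in
the `i`-th resonator, and density `ρ₀` and bulk modulus `κ₀` in the background. -/
structure ResonatorChain where
  L : ℝ
  L_pos : 0 < L
  N : ℕ
  xL : Fin N → ℝ
  xR : Fin N → ℝ
  zero_le_xL : ∀ i, 0 ≤ xL i
  xL_lt_xR : ∀ i, xL i < xR i
  xR_le_L : ∀ i, xR i ≤ L
  ordered : ∀ i j, i < j → xR i ≤ xL j
  ρ₀ : ℝ
  ρ₁ : ℝ
  κ₀ : ℝ
  κ : Fin N → ℝ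
  ρ₀_pos : 0 < ρ₀
  ρ₁_pos : 0 < ρ₁
  κ₀_pos : 0 < κ₀
  κ_pos : ∀ i, 0 < κ i

namespace ResonatorChain

/-- The `i`-th resonator, repeated periodically along the lattice `Λ = L ℤ`. -/
def resonator (C : ResonatorChain) (i : Fin C.N) : Set ℝ :=
  ⋃ m : ℤ, Ioo (C.xL i + m * C.L) (C.xR i + m * C.L)

/-- The union `D` of all the resonators. -/
def D (C : ResonatorChain) : Set ℝ := ⋃ i, C.resonator i

open Classical in
/-- The density: `ρ₁` in `D` and `ρ₀` outside `D`. -/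
noncomputable def rho (C : ResonatorChain) (x : ℝ) : ℝ := if x ∈ C.D then C.ρ₁ else C.ρ₀

/-- The bulk modulus: `κ i` in the `i`-th resonator and `κ₀` outside `D`
(see `kappa_of_mem` and `kappa_of_not_mem`). -/
noncomputable def kappa (C : ResonatorChain) (x : ℝ) : ℝ :=
  C.κ₀ + ∑ i, (C.resonator i).indicator (fun _ => C.κ i - C.κ₀) x

theorem kappa_of_not_mem (C : ResonatorChain) {x : ℝ} (hx : x ∉ C.D) : C.kappa x = C.κ₀ := by
  have : ∀ i, x ∉ C.resonator i := by simpa [D] using hx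
  simp [kappa, this]

theorem resonator_disjoint (C : ResonatorChain) {i j : Fin C.N} {x : ℝ}
    (hi : x ∈ C.resonator i) (hj : x ∈ C.resonator j) : i = j := by
  simp only [resonator, mem_iUnion, mem_Ioo] at hi hj
  obtain ⟨m, hm1, hm2⟩ := hi
  obtain ⟨n, hn1, hn2⟩ := hj
  have hL := C.L_pos
  have h1 := C.zero_le_xL i
  have h2 := C.zero_le_xL j
  have h3 := C.xR_le_L i
  have h4 := C.xR_le_L j
  have a1 : m < n + 1 := by
    have : (m : ℝ) < n + 1 := by
      by_contra! h
      nlinarith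
    exact_mod_cast this
  have a2 : n < m + 1 := by
    have : (n : ℝ) < m + 1 := by
      by_contra! h
      nlinarith
    exact_mod_cast this
  obtain rfl : m = n := by omega
  rcases lt_trichotomy i j with h | h | h
  · have := C.ordered i j h
    linarith
  · exact h
  · have := C.ordered j i h
    linarith

theorem kappa_of_mem (C : ResonatorChain) {i : Fin C.N} {x : ℝ} (hx : x ∈ C.resonator i) :
    C.kappa x = C.κ i := by
  rw [kappa, Finset.sum_eq_single i]
  · simp [hx]
  · intro j _ hj
    exact indicator_of_notMem (fun h => hj (C.resonator_disjoint h hx)) _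
  · simp

theorem rho_pos (C : ResonatorChain) (x : ℝ) : 0 < C.rho x := by
  unfold rho
  split_ifs
  exacts [C.ρ₁_pos, C.ρ₀_pos]

/-- Lebesgue measure on the unit cell `Y`. -/
noncomputable def cellMeasure (C : ResonatorChain) : Measure ℝ := volume.restrict (Ioc 0 C.L)

/-- The Hilbert space `L²(Y; ℂ)`; a quasiperiodic function is identified with its restriction to
the unit cell. -/
abbrev Cell (C : ResonatorChain) : Type := Lp ℂ 2 C.cellMeasure

/-- `u` has the (complex) quasimomentum `k`: `u (x + ℓ) = exp (i k ℓ) u x` for `ℓ ∈ Λ = L ℤ`. -/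
def IsQuasiperiodic (C : ResonatorChain) (k : ℂ) (u : ℝ → ℂ) : Prop :=
  ∀ (m : ℤ) (x : ℝ), u (x + m * C.L) = Complex.exp (Complex.I * k * (m * C.L)) * u x

/-- `f` is the restriction to the unit cell of a function `u` with quasimomentum `k` such that `u`
and the flux `p = (1 / ρ) u'` are locally absolutely continuous on `ℝ`, and
`g = - κ ((1 / ρ) u')'` on the unit cell (`q` is the derivative of `p`). Since `f` and `g` are
elements of `L²`, this says `u ∈ H¹` and `(1 / ρ) u' ∈ H¹` locally. -/
def HelmholtzRel (C : ResonatorChain) (k : ℂ) (f g : C.Cell) : Prop :=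
  ∃ u p q : ℝ → ℂ,
    C.IsQuasiperiodic k u ∧
    IsWeakDeriv u (fun x => (C.rho x : ℂ) * p x) ∧
    IsWeakDeriv p q ∧
    f =ᵐ[C.cellMeasure] u ∧
    g =ᵐ[C.cellMeasure] fun x => -((C.kappa x : ℂ) * q x)

end ResonatorChain

theorem IsWeakDeriv.intervalIntegrable {u v : ℝ → ℂ} (h : IsWeakDeriv u v) (a b : ℝ) :
    IntervalIntegrable v volume a b :=
  (h.1.integrableOn_isCompact isCompact_uIcc).intervalIntegrable

theorem IsWeakDeriv.add {u v u' v' : ℝ → ℂ} (h : IsWeakDeriv u v) (h' : IsWeakDeriv u' v') :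
    IsWeakDeriv (fun x => u x + u' x) (fun x => v x + v' x) := by
  refine ⟨h.1.add h'.1, fun a b => ?_⟩
  rw [intervalIntegral.integral_add (h.intervalIntegrable a b) (h'.intervalIntegrable a b),
    ← h.2 a b, ← h'.2 a b]
  ring

theorem IsWeakDeriv.const_mul {u v : ℝ → ℂ} (h : IsWeakDeriv u v) (c : ℂ) :
    IsWeakDeriv (fun x => c * u x) (fun x => c * v x) := by
  refine ⟨h.1.smul c, fun a b => ?_⟩
  rw [intervalIntegral.integral_const_mul, ← h.2 a b]
  ring

theorem IsWeakDeriv.continuous {u v : ℝ → ℂ} (h : IsWeakDeriv u v) : Continuous u := by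
  have h1 : u = fun b => u 0 + ∫ x in (0 : ℝ)..b, v x := by
    funext b
    rw [← h.2 0 b]
    ring
  rw [h1]
  exact continuous_const.add
    (intervalIntegral.continuous_primitive h.intervalIntegrable 0)

theorem IsWeakDeriv.ae_eq_zero {u v : ℝ → ℂ} (h : IsWeakDeriv u v) {a b : ℝ}
    (hu : ∀ x ∈ Ioo a b, u x = 0) : ∀ᵐ x, x ∈ Ioo a b → v x = 0 := by
  filter_upwards [LocallyIntegrable.ae_hasDerivAt_integral h.1] with x hx hxab
  have h1 : HasDerivAt u (v x) x := by
    have h2 : u = fun b => u 0 + ∫ x in (0 : ℝ)..b, v x := by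
      funext b
      rw [← h.2 0 b]
      ring
    rw [h2]
    exact (hx 0).const_add _
  have h3 : HasDerivAt u 0 x := by
    refine (hasDerivAt_const x (0 : ℂ)).congr_of_eventuallyEq ?_
    filter_upwards [isOpen_Ioo.mem_nhds hxab] with y hy using hu y hy
  exact h1.unique h3

theorem eq_zero_on_Ioo_of_ae {u : ℝ → ℂ} (hu : Continuous u) {a b : ℝ}
    (h : ∀ᵐ x, x ∈ Ioo a b → u x = 0) : ∀ x ∈ Ioo a b, u x = 0 := by
  have h1 : u =ᵐ[volume.restrict (Ioo a b)] fun _ => (0 : ℂ) :=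
    (ae_restrict_iff' measurableSet_Ioo).2 h
  exact Measure.eqOn_open_of_ae_eq h1 isOpen_Ioo hu.continuousOn continuousOn_const

namespace ResonatorChain

theorem HelmholtzRel.snd_eq_zero {C : ResonatorChain} {k : ℂ} {g : C.Cell}
    (h : C.HelmholtzRel k 0 g) : g = 0 := by
  obtain ⟨u, p, q, -, hu, hp, hf, hg⟩ := h
  have e : C.cellMeasure = volume.restrict (Ioo 0 C.L) :=
    (Measure.restrict_congr_set Ioo_ae_eq_Ioc).symm
  have hu0 : ∀ᵐ x, x ∈ Ioo 0 C.L → u x = 0 := by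
    rw [← ae_restrict_iff' measurableSet_Ioo, ← e]
    filter_upwards [hf, Lp.coeFn_zero ℂ 2 C.cellMeasure] with x h1 h2
    rw [← h1, h2]
    rfl
  have hp0 : ∀ᵐ x, x ∈ Ioo 0 C.L → p x = 0 := by
    filter_upwards [hu.ae_eq_zero (eq_zero_on_Ioo_of_ae hu.continuous hu0)] with x hx hx'
    have h1 := hx hx'
    have h2 : (C.rho x : ℂ) ≠ 0 := by exact_mod_cast (C.rho_pos x).ne'
    exact (mul_eq_zero.1 h1).resolve_left h2
  have hq0 := hp.ae_eq_zero (eq_zero_on_Ioo_of_ae hp.continuous hp0)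
  rw [Lp.eq_zero_iff_ae_eq_zero]
  rw [← ae_restrict_iff' measurableSet_Ioo, ← e] at hq0
  filter_upwards [hg, hq0] with x h1 h2
  rw [h1, h2]
  simp

/-- The graph of `𝓛(k)`, as a subspace of `L²(Y) × L²(Y)`. -/
noncomputable def helmholtzGraph (C : ResonatorChain) (k : ℂ) :
    Submodule ℂ (C.Cell × C.Cell) where
  carrier := {w | C.HelmholtzRel k w.1 w.2}
  add_mem' := by
    rintro ⟨f, g⟩ ⟨f', g'⟩ ⟨u, p, q, h1, h2, h3, h4, h5⟩ ⟨u', p', q', h1', h2', h3', h4', h5'⟩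
    refine ⟨fun x => u x + u' x, fun x => p x + p' x, fun x => q x + q' x, ?_, ?_, h3.add h3',
      ?_, ?_⟩
    · intro m x
      simp only [h1 m x, h1' m x]
      ring
    · convert h2.add h2' using 2
      ring
    · filter_upwards [h4, h4', Lp.coeFn_add f f'] with x a b c
      simp only [Prod.mk_add_mk] at *
      rw [c, Pi.add_apply, a, b]
    · filter_upwards [h5, h5', Lp.coeFn_add g g'] with x a b c
      simp only [Prod.mk_add_mk] at *
      rw [c, Pi.add_apply, a, b]
      ring
  zero_mem' := by
    have h0 : IsWeakDeriv (fun _ => 0) (fun _ => 0) :=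
      ⟨locallyIntegrable_const _, fun a b => by simp⟩
    refine ⟨fun _ => 0, fun _ => 0, fun _ => 0, fun m x => by simp, by simpa using h0, h0, ?_, ?_⟩
    · filter_upwards [Lp.coeFn_zero ℂ 2 C.cellMeasure] with x h
      exact h
    · filter_upwards [Lp.coeFn_zero ℂ 2 C.cellMeasure] with x h
      simpa using h
  smul_mem' := by
    rintro c ⟨f, g⟩ ⟨u, p, q, h1, h2, h3, h4, h5⟩
    refine ⟨fun x => c * u x, fun x => c * p x, fun x => c * q x, ?_, ?_, h3.const_mul c, ?_, ?_⟩
    · intro m x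
      simp only [h1 m x]
      ring
    · convert h2.const_mul c using 2
      ring
    · filter_upwards [h4, Lp.coeFn_smul c f] with x a b
      simp only [Prod.smul_mk] at *
      rw [b, Pi.smul_apply, a, smul_eq_mul]
    · filter_upwards [h5, Lp.coeFn_smul c g] with x a b
      simp only [Prod.smul_mk] at *
      rw [b, Pi.smul_apply, a, smul_eq_mul]
      ring

/-- The operator `𝓛(k) u = - κ ((1 / ρ) u')'` in `L²(Y; ℂ)`, restricted to functions with complex
quasimomentum `k`; its graph is described by `mem_graph_operator`. -/
noncomputable def operator (C : ResonatorChain) (k : ℂ) : C.Cell →ₗ.[ℂ] C.Cell :=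
  (C.helmholtzGraph k).toLinearPMap

theorem mem_graph_operator (C : ResonatorChain) (k : ℂ) (f g : C.Cell) :
    (f, g) ∈ (C.operator k).graph ↔ C.HelmholtzRel k f g := by
  rw [operator, Submodule.toLinearPMap_graph_eq]
  · exact Iff.rfl
  · rintro ⟨f, g⟩ h (rfl : f = 0)
    exact HelmholtzRel.snd_eq_zero h

/-- The spectrum of `𝓛(α, β)`, the restriction of `𝓛` to quasimomentum `α + i β`. -/
noncomputable def blochSpectrum (C : ResonatorChain) (α β : ℝ) : Set ℂ :=
  unboundedSpectrum (C.operator ((α : ℂ) + Complex.I * (β : ℂ)))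

/-- The real Brillouin zone `ℝ / Λ* = ℝ / (2π / L) ℤ`, represented by `(-π / L, π / L]`. -/
def brillouinZone (C : ResonatorChain) : Set ℝ := Ioc (-(Real.pi / C.L)) (Real.pi / C.L)

/-- The spectrum of `𝓛`: the union of the spectra of `𝓛(α) = 𝓛(α, 0)` over real `α`. -/
noncomputable def spectrum (C : ResonatorChain) : Set ℂ :=
  ⋃ α ∈ C.brillouinZone, C.blochSpectrum α 0

/-- The (real) resolvent set `ℝ \ σ(𝓛)`. -/
def resolventSet (C : ResonatorChain) : Set ℝ := {t : ℝ | (t : ℂ) ∉ C.spectrum}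

/-- The pairs `(α, β)` with `α ∈ {-π / L, 0, π / L}` and `β ≠ 0`. -/
def gapQuasimomenta (C : ResonatorChain) : Set (ℝ × ℝ) :=
  {-(Real.pi / C.L), 0, Real.pi / C.L} ×ˢ {0}ᶜ

/-- The complex band structure: the triples `(α, β, t)` with `α` in the Brillouin zone, `β > 0` and
`t` a real point of the spectrum of `𝓛(α, β)`. -/
def complexBandStructure (C : ResonatorChain) : Set (ℝ × ℝ × ℝ) :=
  {w | w.1 ∈ C.brillouinZone ∧ 0 < w.2.1 ∧ (w.2.2 : ℂ) ∈ C.blochSpectrum w.1 w.2.1}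

/-- The complex bands: the connected components of the complex band structure. -/
def complexBands (C : ResonatorChain) : Set (Set (ℝ × ℝ × ℝ)) :=
  componentsOf C.complexBandStructure

/-- The band gaps: the connected components of the real resolvent set. -/
def bandGaps (C : ResonatorChain) : Set (Set ℝ) := componentsOf C.resolventSet

end ResonatorChain

/-! This is Floquet theory. Write `p = u'/ρ`. The equation `-κ p' - z u = h` on the cell is a
first-order system in `(u, p)`, determined by its Cauchy data `(a, b)` at `0`. Quasimomentum `k`
means `u(L) = μ u(0)` and `p(L) = μ p(0)` with `μ = exp(ikL)` (`helmholtzRel_iff`). If `T(z)` is the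
transfer matrix from `0` to `L`, then `z` is in the spectrum exactly when `det (T(z) - μ) = 0`.
Constancy of the Wronskian gives `det T = 1` (`transfer_det`), so the condition becomes `2 cos(kL) =
Δ(z)`, where `Δ = tr T` (`mem_unboundedSpectrum_iff`).

For real `t` the discriminant is real and continuous. With `k = α + iβ` the condition splits into `2
cos(αL) cosh(βL) = Δ(t)` and `sin(αL) sinh(βL) = 0`. At `β = 0` it is solvable exactly when `|Δ| ≤
2`, so the resolvent set is `{|Δ| > 2}`. For `β > 0` it forces `α = 0` or `α = π/L` according to the
sign of `Δ`, and `cosh(βL) = |Δ|/2`. Hence the complex band structure is the graph of a continuous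
function over the resolvent set (`mem_complexBandStructure_iff`). The projection to `t` is thus a
homeomorphism and matches connected components.

The coefficients are only bounded and measurable, so the system is solved as a Volterra integral
equation. The powers of its operator decay factorially, which gives solvability for every `z` and
continuity in `z`. -/

open scoped BoundedContinuousFunction

/-! ### Inverting `1 + zK` when the powers of `K` decay factorially -/

namespace ContinuousLinearMap

variable {E : Type*} [NormedAddCommGroup E] [NormedSpace ℂ E] [CompleteSpace E] {K : E →L[ℂ] E}
  {B : ℝ}

/-- Some power of `-zK` has norm below one, so `1 - (-zK)ⁿ` is invertible by the Neumann series. It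
factors as `1 + zK` times a geometric sum that commutes with it, so both factors are units; `zK`
itself need not be small. -/
theorem isUnit_one_add_smul (h : ∀ n : ℕ, ‖K ^ n‖ ≤ B ^ n / n.factorial) (z : ℂ) :
    IsUnit (1 + z • K) := by
  obtain ⟨n, hn⟩ := ((FloorSemiring.tendsto_pow_div_factorial_atTop (‖z‖ * B)).eventually
    (gt_mem_nhds one_pos)).exists
  have h1 : ‖((-z) • K) ^ n‖ < 1 := by
    rw [smul_pow, norm_smul, norm_pow, norm_neg]
    refine lt_of_le_of_lt (mul_le_mul_of_nonneg_left (h n) (by positivity)) ?_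
    rwa [← mul_div_assoc, ← mul_pow]
  have h2 := isUnit_one_sub_of_norm_lt_one h1
  rw [← mul_neg_geom_sum] at h2
  have h3 : 1 - (-z) • K = 1 + z • K := by
    rw [neg_smul, sub_neg_eq_add]
  rw [← h3]
  refine ((Commute.isUnit_mul_iff ?_).1 h2).1
  rw [commute_iff_eq, mul_neg_geom_sum, geom_sum_mul_neg]

theorem continuous_inverse_one_add_smul (h : ∀ n : ℕ, ‖K ^ n‖ ≤ B ^ n / n.factorial) :
    Continuous fun z : ℂ => Ring.inverse (1 + z • K) := by
  refine continuous_iff_continuousAt.2 fun z => ?_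
  have h' := NormedRing.inverse_continuousAt (isUnit_one_add_smul h z).unit
  exact ContinuousAt.comp (f := fun z : ℂ => 1 + z • K) h' (by fun_prop)

end ContinuousLinearMap

/-! ### Periodicity, measurability and bounds of the coefficients -/

namespace ResonatorChain

variable (C : ResonatorChain)

theorem measurableSet_resonator (i : Fin C.N) : MeasurableSet (C.resonator i) :=
  MeasurableSet.iUnion fun _ => measurableSet_Ioo

theorem measurable_rho : Measurable C.rho :=
  Measurable.ite (MeasurableSet.iUnion C.measurableSet_resonator) measurable_const measurable_const

theorem measurable_kappa : Measurable C.kappa :=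
  measurable_const.add (Finset.measurable_sum _ fun i _ =>
    measurable_const.indicator (C.measurableSet_resonator i))

theorem add_mem_resonator_iff (i : Fin C.N) (x : ℝ) (n : ℤ) :
    x + n * C.L ∈ C.resonator i ↔ x ∈ C.resonator i := by
  simp only [resonator, mem_iUnion, mem_Ioo]
  constructor
  · rintro ⟨m, h1, h2⟩
    refine ⟨m - n, ?_, ?_⟩ <;> push_cast <;> linarith
  · rintro ⟨m, h1, h2⟩
    refine ⟨m + n, ?_, ?_⟩ <;> push_cast <;> linarith

theorem rho_add (x : ℝ) (n : ℤ) : C.rho (x + n * C.L) = C.rho x := by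
  have h : x + n * C.L ∈ C.D ↔ x ∈ C.D := by
    simp only [D, mem_iUnion, add_mem_resonator_iff]
  by_cases hx : x ∈ C.D
  · rw [rho, rho, if_pos hx, if_pos (h.2 hx)]
  · rw [rho, rho, if_neg hx, if_neg (h.not.2 hx)]

theorem kappa_pos (x : ℝ) : 0 < C.kappa x := by
  by_cases hx : x ∈ C.D
  · obtain ⟨i, hi⟩ := mem_iUnion.1 hx
    rw [C.kappa_of_mem hi]
    exact C.κ_pos i
  · rw [C.kappa_of_not_mem hx]
    exact C.κ₀_pos

/-- The reciprocal of the bulk modulus. -/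
noncomputable def compliance (x : ℝ) : ℝ := (C.kappa x)⁻¹

theorem measurable_compliance : Measurable C.compliance := C.measurable_kappa.inv

theorem kappa_mul_compliance (x : ℝ) : (C.kappa x : ℂ) * (C.compliance x : ℂ) = 1 := by
  rw [compliance, ← Complex.ofReal_mul, mul_inv_cancel₀ (C.kappa_pos x).ne', Complex.ofReal_one]

theorem abs_rho_le (x : ℝ) : |C.rho x| ≤ C.ρ₀ + C.ρ₁ := by
  rw [abs_of_pos (C.rho_pos x), rho]
  split_ifs <;> linarith [C.ρ₀_pos, C.ρ₁_pos]

theorem abs_compliance_le (x : ℝ) : |C.compliance x| ≤ C.κ₀⁻¹ + ∑ i, (C.κ i)⁻¹ := by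
  have h0 := inv_pos.2 C.κ₀_pos
  have h1 : ∀ i ∈ Finset.univ, 0 ≤ (C.κ i)⁻¹ := fun i _ => (inv_pos.2 (C.κ_pos i)).le
  rw [compliance, abs_of_pos (inv_pos.2 (C.kappa_pos x))]
  by_cases hx : x ∈ C.D
  · obtain ⟨i, hi⟩ := mem_iUnion.1 hx
    rw [C.kappa_of_mem hi]
    linarith [Finset.single_le_sum h1 (Finset.mem_univ i)]
  · rw [C.kappa_of_not_mem hx]
    linarith [Finset.sum_nonneg h1]

/-! ### Weighted primitives on the unit cell -/

instance : IsFiniteMeasure C.cellMeasure := by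
  unfold cellMeasure
  infer_instance

/-- The retraction of `ℝ` onto the unit cell `[0, L]`. -/
noncomputable def clamp (x : ℝ) : ℝ := max 0 (min x C.L)

theorem continuous_clamp : Continuous C.clamp := by
  unfold clamp
  fun_prop

theorem clamp_nonneg (x : ℝ) : 0 ≤ C.clamp x := le_max_left _ _

theorem clamp_le (x : ℝ) : C.clamp x ≤ C.L := max_le C.L_pos.le (min_le_right _ _)

theorem clamp_of_mem {x : ℝ} (h0 : 0 ≤ x) (h1 : x ≤ C.L) : C.clamp x = x := by
  rw [clamp, min_eq_left h1, max_eq_right h0]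

theorem clamp_zero : C.clamp 0 = 0 := C.clamp_of_mem le_rfl C.L_pos.le

theorem clamp_L : C.clamp C.L = C.L := C.clamp_of_mem C.L_pos.le le_rfl

theorem Ioc_clamp_subset (x : ℝ) : Ioc 0 (C.clamp x) ⊆ Ioc 0 C.L :=
  Ioc_subset_Ioc_right (C.clamp_le x)

/-- The restriction of a continuous function to the unit cell, extended by constants. -/
noncomputable def clampFunction (u : ℝ → ℂ) (hu : Continuous u) : ℝ →ᵇ ℂ :=
  BoundedContinuousFunction.ofNormedAddCommGroup (fun x => u (C.clamp x))
    (hu.comp C.continuous_clamp)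
    (isCompact_Icc.exists_bound_of_continuousOn (s := Icc 0 C.L) hu.continuousOn).choose
    fun x => (isCompact_Icc.exists_bound_of_continuousOn (s := Icc 0 C.L)
      hu.continuousOn).choose_spec _ ⟨C.clamp_nonneg x, C.clamp_le x⟩

/-- The inclusion of the bounded continuous functions in `L²(Y)`. -/
noncomputable def toCell : (ℝ →ᵇ ℂ) →L[ℂ] C.Cell :=
  BoundedContinuousFunction.toLp 2 C.cellMeasure ℂ

theorem coeFn_toCell (u : ℝ →ᵇ ℂ) : C.toCell u =ᵐ[C.cellMeasure] u :=
  BoundedContinuousFunction.coeFn_toLp 2 C.cellMeasure ℂ u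

section Primitive

variable {w : ℝ → ℝ} {M : ℝ} (hw : Measurable w) (hM : ∀ x, |w x| ≤ M)

include hw hM in
theorem integrable_weight_mul {μ : Measure ℝ} {f : ℝ → ℂ} (hf : Integrable f μ) :
    Integrable (fun s => (w s : ℂ) * f s) μ :=
  hf.bdd_mul (Complex.measurable_ofReal.comp hw).aestronglyMeasurable
    (Filter.Eventually.of_forall fun x => by
      simpa only [Complex.norm_real, Real.norm_eq_abs] using hM x)

theorem integrable_cell (f : C.Cell) : Integrable f C.cellMeasure :=
  (Lp.memLp f).integrable one_le_two

/-- Hölder's inequality on a set of finite measure; this makes the primitive bounded from `L²` to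
the sup norm. -/
theorem integral_norm_cell_le (f : C.Cell) :
    ∫ s, ‖f s‖ ∂C.cellMeasure ≤ ‖f‖ * (C.cellMeasure univ ^ (1 / 2 : ℝ)).toReal := by
  have h := eLpNorm_le_eLpNorm_mul_rpow_measure_univ (p := 1) (q := 2) one_le_two
    (Lp.aestronglyMeasurable f)
  rw [eLpNorm_one_eq_lintegral_enorm] at h
  rw [integral_norm_eq_lintegral_enorm (Lp.aestronglyMeasurable f), Lp.norm_def, ← ENNReal.toReal_mul]
  have e : (1 / (1 : ENNReal).toReal - 1 / (2 : ENNReal).toReal) = (1 / 2 : ℝ) := by norm_num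
  rw [e] at h
  refine ENNReal.toReal_mono (ENNReal.mul_ne_top (Lp.eLpNorm_ne_top f) ?_) h
  exact ENNReal.rpow_ne_top_of_nonneg (by norm_num) (measure_ne_top _ _)

include hw hM in
theorem intervalIntegrable_weight_mul (f : C.Cell) (x y : ℝ) :
    IntervalIntegrable (fun s => (w s : ℂ) * f s) volume (C.clamp x) (C.clamp y) := by
  rw [intervalIntegrable_iff]
  refine IntegrableOn.mono_set (integrable_weight_mul hw hM (C.integrable_cell f)) ?_
  exact Ioc_subset_Ioc (le_min (C.clamp_nonneg x) (C.clamp_nonneg y))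
    (max_le (C.clamp_le x) (C.clamp_le y))

include hw hM in
theorem continuous_weighted_primitive (f : C.Cell) :
    Continuous fun x => ∫ s in (0 : ℝ)..C.clamp x, (w s : ℂ) * f s := by
  have h : IntegrableOn (fun s => (w s : ℂ) * f s) (uIcc 0 C.L) := by
    rw [uIcc_of_le C.L_pos.le, integrableOn_Icc_iff_integrableOn_Ioc]
    exact integrable_weight_mul hw hM (C.integrable_cell f)
  refine (intervalIntegral.continuousOn_primitive_interval h).comp_continuous C.continuous_clamp
    fun x => ?_
  rw [uIcc_of_le C.L_pos.le]
  exact ⟨C.clamp_nonneg x, C.clamp_le x⟩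

include hw hM in
theorem norm_weighted_primitive_le (f : C.Cell) (x : ℝ) :
    ‖∫ s in (0 : ℝ)..C.clamp x, (w s : ℂ) * f s‖ ≤
      M * (C.cellMeasure univ ^ (1 / 2 : ℝ)).toReal * ‖f‖ := by
  have hM0 : 0 ≤ M := (abs_nonneg _).trans (hM 0)
  have hi := integrable_weight_mul hw hM (C.integrable_cell f)
  calc ‖∫ s in (0 : ℝ)..C.clamp x, (w s : ℂ) * f s‖
      ≤ ∫ s in Ioc 0 (C.clamp x), ‖(w s : ℂ) * f s‖ := by
        rw [intervalIntegral.integral_of_le (C.clamp_nonneg x)]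
        exact norm_integral_le_integral_norm _
    _ ≤ ∫ s in Ioc 0 C.L, ‖(w s : ℂ) * f s‖ :=
        setIntegral_mono_set hi.norm (Filter.Eventually.of_forall fun s => norm_nonneg _)
          (C.Ioc_clamp_subset x).eventuallyLE
    _ ≤ ∫ s in Ioc 0 C.L, M * ‖f s‖ := by
        refine integral_mono hi.norm ((C.integrable_cell f).norm.const_mul M) fun s => ?_
        simp only [norm_mul, Complex.norm_real, Real.norm_eq_abs]
        exact mul_le_mul_of_nonneg_right (hM s) (norm_nonneg _)
    _ = M * ∫ s, ‖f s‖ ∂C.cellMeasure := integral_const_mul _ _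
    _ ≤ M * (‖f‖ * (C.cellMeasure univ ^ (1 / 2 : ℝ)).toReal) :=
        mul_le_mul_of_nonneg_left (C.integral_norm_cell_le f) hM0
    _ = _ := by ring

/-- The primitive `x ↦ ∫₀ˣ w f` on the unit cell, extended by constants, as a bounded operator from
`L²(Y)` to the bounded continuous functions. -/
noncomputable def weightedPrimitive : C.Cell →L[ℂ] (ℝ →ᵇ ℂ) :=
  LinearMap.mkContinuous
    { toFun := fun f => BoundedContinuousFunction.ofNormedAddCommGroup
        (fun x => ∫ s in (0 : ℝ)..C.clamp x, (w s : ℂ) * f s)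
        (C.continuous_weighted_primitive hw hM f) _ (C.norm_weighted_primitive_le hw hM f)
      map_add' := fun f g => by
        ext x
        simp only [BoundedContinuousFunction.coe_ofNormedAddCommGroup,
          BoundedContinuousFunction.coe_add, Pi.add_apply]
        have hi := fun h => C.intervalIntegrable_weight_mul hw hM h 0 x
        rw [clamp_zero] at hi
        rw [← intervalIntegral.integral_add (hi f) (hi g)]
        refine intervalIntegral.integral_congr_ae_restrict ?_
        rw [uIoc_of_le (C.clamp_nonneg x)]
        filter_upwards [ae_restrict_of_ae_restrict_of_subset (C.Ioc_clamp_subset x)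
          (Lp.coeFn_add f g)] with s hs
        rw [hs, Pi.add_apply]
        ring
      map_smul' := fun c f => by
        ext x
        simp only [BoundedContinuousFunction.coe_ofNormedAddCommGroup, RingHom.id_apply,
          BoundedContinuousFunction.coe_smul, smul_eq_mul]
        rw [← intervalIntegral.integral_const_mul]
        refine intervalIntegral.integral_congr_ae_restrict ?_
        rw [uIoc_of_le (C.clamp_nonneg x)]
        filter_upwards [ae_restrict_of_ae_restrict_of_subset (C.Ioc_clamp_subset x)
          (Lp.coeFn_smul c f)] with s hs
        rw [hs, Pi.smul_apply, smul_eq_mul]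
        ring }
    (M * (C.cellMeasure univ ^ (1 / 2 : ℝ)).toReal)
    fun f => (BoundedContinuousFunction.norm_le
      ((norm_nonneg _).trans (C.norm_weighted_primitive_le hw hM f 0))).2
        (C.norm_weighted_primitive_le hw hM f)

theorem weightedPrimitive_apply (f : C.Cell) (x : ℝ) :
    C.weightedPrimitive hw hM f x = ∫ s in (0 : ℝ)..C.clamp x, (w s : ℂ) * f s := rfl

theorem weightedPrimitive_eq_of_ae (f : C.Cell) {u : ℝ → ℂ} (h : f =ᵐ[C.cellMeasure] u) (x : ℝ) :
    C.weightedPrimitive hw hM f x = ∫ s in (0 : ℝ)..C.clamp x, (w s : ℂ) * u s := by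
  rw [weightedPrimitive_apply]
  refine intervalIntegral.integral_congr_ae_restrict ?_
  rw [uIoc_of_le (C.clamp_nonneg x)]
  filter_upwards [ae_restrict_of_ae_restrict_of_subset (C.Ioc_clamp_subset x) h] with s hs
  rw [hs]

theorem weightedPrimitive_toCell_apply (u : ℝ →ᵇ ℂ) (x : ℝ) :
    C.weightedPrimitive hw hM (C.toCell u) x = ∫ s in (0 : ℝ)..C.clamp x, (w s : ℂ) * u s :=
  C.weightedPrimitive_eq_of_ae hw hM _ (C.coeFn_toCell u) x

theorem weightedPrimitive_zero (f : C.Cell) : C.weightedPrimitive hw hM f 0 = 0 := by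
  rw [weightedPrimitive_apply, clamp_zero, intervalIntegral.integral_same]

/-- A pointwise bound by a multiple of `xⁿ` gains a power under integration. -/
theorem norm_weightedPrimitive_toCell_le {u : ℝ →ᵇ ℂ} {A : ℝ} {n : ℕ}
    (hu : ∀ x, ‖u x‖ ≤ A * C.clamp x ^ n) (x : ℝ) :
    ‖C.weightedPrimitive hw hM (C.toCell u) x‖ ≤ M * A / (n + 1) * C.clamp x ^ (n + 1) := by
  have hM0 : 0 ≤ M := (abs_nonneg _).trans (hM 0)
  rw [weightedPrimitive_toCell_apply]
  have h1 : ‖∫ s in (0 : ℝ)..C.clamp x, (w s : ℂ) * u s‖ ≤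
      ∫ s in (0 : ℝ)..C.clamp x, M * A * s ^ n := by
    refine intervalIntegral.norm_integral_le_of_norm_le (C.clamp_nonneg x)
      (Filter.Eventually.of_forall fun s hs => ?_)
      ((continuous_const.mul (continuous_pow n)).intervalIntegrable _ _)
    have h2 := hu s
    rw [C.clamp_of_mem hs.1.le (hs.2.trans (C.clamp_le x))] at h2
    rw [norm_mul, Complex.norm_real, Real.norm_eq_abs, mul_assoc]
    exact mul_le_mul (hM s) h2 (norm_nonneg _) hM0
  refine h1.trans (le_of_eq ?_)
  rw [intervalIntegral.integral_const_mul, integral_pow]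
  simp
  ring

end Primitive

/-! ### The Volterra operator and its resolvent -/

/-- The primitive weighted by the density. -/
noncomputable def primRho : C.Cell →L[ℂ] (ℝ →ᵇ ℂ) :=
  C.weightedPrimitive C.measurable_rho C.abs_rho_le

/-- The primitive weighted by the reciprocal of the bulk modulus. -/
noncomputable def primKappa : C.Cell →L[ℂ] (ℝ →ᵇ ℂ) :=
  C.weightedPrimitive C.measurable_compliance C.abs_compliance_le

/-- The Volterra operator of the differential equation `-κ ((1 / ρ) u')' = z u`. -/
noncomputable def volterra : (ℝ →ᵇ ℂ) →L[ℂ] (ℝ →ᵇ ℂ) :=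
  C.primRho ∘L C.toCell ∘L C.primKappa ∘L C.toCell

theorem volterra_apply (u : ℝ →ᵇ ℂ) :
    C.volterra u = C.primRho (C.toCell (C.primKappa (C.toCell u))) := rfl

/-- Each application integrates twice. One integration alone supplies a factor `x / (n + 1)`, and
this already builds up the factorial. -/
theorem exists_norm_volterra_pow_le : ∃ B : ℝ, 0 ≤ B ∧ ∀ n : ℕ,
    ‖C.volterra ^ n‖ ≤ B ^ n / n.factorial := by
  set M₁ := C.ρ₀ + C.ρ₁
  set M₂ := C.κ₀⁻¹ + ∑ i, (C.κ i)⁻¹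
  have hM₁ : 0 ≤ M₁ := (abs_nonneg _).trans (C.abs_rho_le 0)
  have hM₂ : 0 ≤ M₂ := (abs_nonneg _).trans (C.abs_compliance_le 0)
  have hL := C.L_pos
  have key : ∀ (n : ℕ) (u : ℝ →ᵇ ℂ) (x : ℝ), ‖(C.volterra ^ n) u x‖ ≤
      (M₁ * M₂ * C.L) ^ n * ‖u‖ / n.factorial * C.clamp x ^ n := by
    intro n
    induction n with
    | zero =>
      intro u x
      simpa using u.norm_coe_le_norm x
    | succ n ih =>
      intro u x
      rw [pow_succ', mul_apply_eq_comp, volterra_apply]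
      have h1 := C.norm_weightedPrimitive_toCell_le C.measurable_compliance C.abs_compliance_le
        (ih u)
      -- The gain of the inner integration is given up for a factor `L`, so that only the outer one
      -- raises the power.
      have h2 : ∀ y, ‖C.primKappa (C.toCell ((C.volterra ^ n) u)) y‖ ≤
          M₂ * C.L * ((M₁ * M₂ * C.L) ^ n * ‖u‖ / n.factorial) * C.clamp y ^ n := by
        intro y
        refine (h1 y).trans ?_
        have h3 : C.clamp y / (n + 1) ≤ C.L :=
          (div_le_self (C.clamp_nonneg y) (by linarith [n.cast_nonneg (α := ℝ)])).trans
            (C.clamp_le y)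
        have h4 : 0 ≤ M₂ * ((M₁ * M₂ * C.L) ^ n * ‖u‖ / n.factorial) * C.clamp y ^ n := by
          have := C.clamp_nonneg y
          positivity
        calc _ = M₂ * ((M₁ * M₂ * C.L) ^ n * ‖u‖ / n.factorial) * C.clamp y ^ n *
              (C.clamp y / (n + 1)) := by ring
          _ ≤ _ := mul_le_mul_of_nonneg_left h3 h4
          _ = _ := by ring
      refine (C.norm_weightedPrimitive_toCell_le C.measurable_rho C.abs_rho_le h2 x).trans
        (le_of_eq ?_)
      change M₁ * _ / _ * _ = _
      rw [Nat.factorial_succ]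
      push_cast
      have : (n.factorial : ℝ) ≠ 0 := by exact_mod_cast n.factorial_ne_zero
      have : (n : ℝ) + 1 ≠ 0 := by positivity
      field_simp
      ring
  -- The second `L` absorbs `clamp x ^ n ≤ L ^ n`.
  refine ⟨M₁ * M₂ * C.L * C.L, by positivity, fun n => ?_⟩
  refine ContinuousLinearMap.opNorm_le_bound _ (by positivity) fun u => ?_
  refine (BoundedContinuousFunction.norm_le (by positivity)).2 fun x => (key n u x).trans ?_
  have h := pow_le_pow_left₀ (C.clamp_nonneg x) (C.clamp_le x) n
  calc _ ≤ (M₁ * M₂ * C.L) ^ n * ‖u‖ / n.factorial * C.L ^ n :=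
        mul_le_mul_of_nonneg_left h (by positivity)
    _ = _ := by rw [mul_pow (M₁ * M₂ * C.L) C.L]; ring

theorem isUnit_one_add_smul_volterra (z : ℂ) : IsUnit (1 + z • C.volterra) := by
  obtain ⟨B, -, h⟩ := C.exists_norm_volterra_pow_le
  exact ContinuousLinearMap.isUnit_one_add_smul h z

/-- The solution operator `(1 + z K)⁻¹`, where `K` is the Volterra operator. -/
noncomputable def solve (z : ℂ) : (ℝ →ᵇ ℂ) →L[ℂ] (ℝ →ᵇ ℂ) := Ring.inverse (1 + z • C.volterra)

theorem solve_eq_iff (z : ℂ) (f u : ℝ →ᵇ ℂ) : C.solve z f = u ↔ u + z • C.volterra u = f := by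
  have h1 := Ring.mul_inverse_cancel _ (C.isUnit_one_add_smul_volterra z)
  have h2 := Ring.inverse_mul_cancel _ (C.isUnit_one_add_smul_volterra z)
  constructor
  · rintro rfl
    exact DFunLike.congr_fun h1 f
  · rintro rfl
    exact DFunLike.congr_fun h2 u

theorem continuous_solve : Continuous C.solve := by
  obtain ⟨B, -, h⟩ := C.exists_norm_volterra_pow_le
  exact ContinuousLinearMap.continuous_inverse_one_add_smul h

end ResonatorChain

/-! ### Weak derivatives of quasiperiodic functions -/

theorem locallyIntegrable_of_intervalIntegrable {v : ℝ → ℂ}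
    (h : ∀ a b : ℝ, IntervalIntegrable v volume a b) : LocallyIntegrable v := by
  intro x
  refine ⟨Ioc (x - 1) (x + 1), Ioc_mem_nhds (by linarith) (by linarith), ?_⟩
  exact (intervalIntegrable_iff_integrableOn_Ioc_of_le (by linarith)).1 (h _ _)

theorem IsWeakDeriv.comp_add_right {u v : ℝ → ℂ} (h : IsWeakDeriv u v) (c : ℝ) :
    IsWeakDeriv (fun x => u (x + c)) (fun x => v (x + c)) := by
  refine ⟨locallyIntegrable_of_intervalIntegrable fun a b => ?_, fun a b => ?_⟩
  · simpa using (h.intervalIntegrable (a + c) (b + c)).comp_add_right c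
  · rw [intervalIntegral.integral_comp_add_right]
    exact h.2 _ _

theorem isWeakDeriv_of_zero {u v : ℝ → ℂ}
    (h : ∀ x, IntervalIntegrable v volume 0 x ∧ u x - u 0 = ∫ s in (0 : ℝ)..x, v s) :
    IsWeakDeriv u v := by
  have hi : ∀ a b, IntervalIntegrable v volume a b := fun a b => (h a).1.symm.trans (h b).1
  refine ⟨locallyIntegrable_of_intervalIntegrable hi, fun a b => ?_⟩
  rw [← intervalIntegral.integral_interval_sub_left (h b).1 (h a).1, ← (h a).2, ← (h b).2]
  ring

/-- Translation carries the integral formula from the first cell to every cell, and telescoping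
joins the cells. The closed interval matters: the case `x = L` is what glues neighbouring cells. -/
theorem isWeakDeriv_of_quasiperiodic {u v : ℝ → ℂ} {L : ℝ} (hL : 0 < L) {μ : ℂ}
    (hu : ∀ (n : ℤ) (x : ℝ), u (x + n * L) = μ ^ n * u x)
    (hv : ∀ (n : ℤ) (x : ℝ), v (x + n * L) = μ ^ n * v x)
    (h : ∀ x ∈ Icc 0 L, IntervalIntegrable v volume 0 x ∧ u x - u 0 = ∫ s in (0 : ℝ)..x, v s) :
    IsWeakDeriv u v := by
  have hcell : ∀ (n : ℤ), ∀ x ∈ Icc 0 L, IntervalIntegrable v volume (n * L) (x + n * L) ∧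
      u (x + n * L) - u (n * L) = ∫ s in (n * L : ℝ)..(x + n * L), v s := by
    intro n x hx
    have h0 := hu n 0
    rw [zero_add] at h0
    constructor
    · have h1 := (((h x hx).1.const_mul (μ ^ n)).comp_sub_right (n * L))
      rw [zero_add] at h1
      refine h1.congr fun s _ => ?_
      rw [← hv, sub_add_cancel]
    · have h1 := intervalIntegral.integral_comp_add_right (a := 0) (b := x) v (n * L)
      rw [zero_add] at h1
      rw [← h1, h0, hu]
      simp only [hv]
      rw [intervalIntegral.integral_const_mul, ← (h x hx).2]
      ring
  have hlattice : ∀ n : ℤ, IntervalIntegrable v volume 0 (n * L) ∧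
      u (n * L) - u 0 = ∫ s in (0 : ℝ)..(n * L), v s := by
    intro n
    have hstep : ∀ m : ℤ, IntervalIntegrable v volume (m * L) ((m + 1 : ℤ) * L) ∧
        u ((m + 1 : ℤ) * L) - u (m * L) = ∫ s in (m * L : ℝ)..((m + 1 : ℤ) * L), v s := by
      intro m
      have e : ((m + 1 : ℤ) * L : ℝ) = L + m * L := by push_cast; ring
      rw [e]
      exact hcell m L ⟨hL.le, le_rfl⟩
    induction n using Int.induction_on with
    | zero => simp
    | succ i ih =>
      obtain ⟨h1, h2⟩ := hstep i
      refine ⟨ih.1.trans h1, ?_⟩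
      rw [← intervalIntegral.integral_add_adjacent_intervals ih.1 h1, ← ih.2, ← h2]
      ring
    | pred i ih =>
      obtain ⟨h1, h2⟩ := hstep (-i - 1)
      rw [sub_add_cancel] at h1 h2
      refine ⟨ih.1.trans h1.symm, ?_⟩
      rw [← intervalIntegral.integral_add_adjacent_intervals ih.1 h1.symm, ← ih.2,
        intervalIntegral.integral_symm, ← h2]
      ring
  refine isWeakDeriv_of_zero fun x => ?_
  have h1 := hlattice ⌊x / L⌋
  have h2 := hcell ⌊x / L⌋ (x - ⌊x / L⌋ * L) ⟨Int.sub_floor_div_mul_nonneg x hL,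
    (Int.sub_floor_div_mul_lt x hL).le⟩
  rw [sub_add_cancel] at h2
  refine ⟨h1.1.trans h2.1, ?_⟩
  rw [← intervalIntegral.integral_add_adjacent_intervals h1.1 h2.1, ← h1.2, ← h2.2]
  ring

/-! ### Reduction to a boundary value problem on the cell -/

namespace ResonatorChain

variable (C : ResonatorChain)

/-- The extension of a function from the unit cell by `φ (x + L) = μ φ (x)`. -/
noncomputable def extend (μ : ℂ) (φ : ℝ → ℂ) (x : ℝ) : ℂ :=
  μ ^ ⌊x / C.L⌋ * φ (x - ⌊x / C.L⌋ * C.L)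

variable {C}

theorem extend_add {μ : ℂ} (hμ : μ ≠ 0) (φ : ℝ → ℂ) (n : ℤ) (x : ℝ) :
    C.extend μ φ (x + n * C.L) = μ ^ n * C.extend μ φ x := by
  have h : (x + n * C.L) / C.L = x / C.L + n := by
    rw [add_div, mul_div_assoc, div_self C.L_pos.ne', mul_one]
  rw [extend, extend, h, Int.floor_add_intCast, zpow_add₀ hμ]
  push_cast
  rw [show x + n * C.L - (⌊x / C.L⌋ + n) * C.L = x - ⌊x / C.L⌋ * C.L by ring]
  ring

theorem extend_of_mem_Ico (μ : ℂ) (φ : ℝ → ℂ) {x : ℝ} (hx : x ∈ Ico 0 C.L) :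
    C.extend μ φ x = φ x := by
  have h : ⌊x / C.L⌋ = 0 := by
    rw [Int.floor_eq_zero_iff]
    exact ⟨div_nonneg hx.1 C.L_pos.le, (div_lt_one C.L_pos).2 hx.2⟩
  simp [extend, h]

/-- The floor jumps at `L`, where the extension takes the value `μ φ(0)`; the boundary condition
says that this is still `φ(L)`. -/
theorem extend_of_mem_Icc {μ : ℂ} {φ : ℝ → ℂ} (hμ : μ ≠ 0) (hφ : φ C.L = μ * φ 0) {x : ℝ}
    (hx : x ∈ Icc 0 C.L) : C.extend μ φ x = φ x := by
  rcases hx.2.eq_or_lt with rfl | h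
  · have h1 := extend_add (C := C) hμ φ 1 0
    rw [extend_of_mem_Ico μ φ ⟨le_rfl, C.L_pos⟩] at h1
    simpa [hφ] using h1
  · exact extend_of_mem_Ico μ φ ⟨hx.1, h⟩

theorem extend_ae_eq (μ : ℂ) (φ : ℝ → ℂ) : C.extend μ φ =ᵐ[C.cellMeasure] φ := by
  have e : C.cellMeasure = volume.restrict (Ioo 0 C.L) :=
    (Measure.restrict_congr_set Ioo_ae_eq_Ioc).symm
  rw [e]
  filter_upwards [ae_restrict_mem measurableSet_Ioo] with x hx
  exact extend_of_mem_Ico μ φ (Ioo_subset_Ico_self hx)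

theorem clampFunction_ae_eq (u : ℝ → ℂ) (hu : Continuous u) :
    C.clampFunction u hu =ᵐ[C.cellMeasure] u := by
  filter_upwards [ae_restrict_mem measurableSet_Ioc] with x hx
  exact congrArg u (C.clamp_of_mem hx.1.le hx.2)

theorem toCell_eq_of_ae {f : C.Cell} {u : ℝ →ᵇ ℂ} (h : f =ᵐ[C.cellMeasure] u) : f = C.toCell u :=
  Lp.ext (h.trans (C.coeFn_toCell u).symm)

/-- The Floquet multiplier `exp (i k L)` of the quasimomentum `k`. -/
noncomputable def multiplier (C : ResonatorChain) (k : ℂ) : ℂ :=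
  Complex.exp (Complex.I * k * C.L)

theorem multiplier_ne_zero (k : ℂ) : C.multiplier k ≠ 0 := Complex.exp_ne_zero _

theorem multiplier_zpow (k : ℂ) (n : ℤ) :
    C.multiplier k ^ n = Complex.exp (Complex.I * k * (n * C.L)) := by
  rw [multiplier, ← Complex.exp_int_mul]
  ring_nf

/-- If `u` is quasiperiodic, so is its flux. -/
theorem flux_quasiperiodic {k : ℂ} {u p : ℝ → ℂ} (hu : C.IsQuasiperiodic k u)
    (h : IsWeakDeriv u fun x => (C.rho x : ℂ) * p x) (hp : Continuous p) :
    p C.L = C.multiplier k * p 0 := by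
  have h1 : ∀ x, u (x + C.L) + -C.multiplier k * u x = 0 := by
    intro x
    have := hu 1 x
    rw [← multiplier_zpow] at this
    simp only [Int.cast_one, one_mul, zpow_one] at this
    rw [this]
    ring
  -- `u(x + L) - μ u(x)` vanishes identically, hence so does its derivative almost everywhere. As
  -- `ρ` is periodic and nonzero, it can be divided out, and continuity of `p` gives the value at
  -- `0`. Any open interval around `0` would do.
  have h2 := ((h.comp_add_right C.L).add (h.const_mul (-C.multiplier k))).ae_eq_zero
    (a := -1) (b := 1) fun x _ => h1 x
  have h3 : ∀ᵐ x, x ∈ Ioo (-1 : ℝ) 1 → p (x + C.L) + -C.multiplier k * p x = 0 := by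
    filter_upwards [h2] with x hx hx'
    have h4 := hx hx'
    have h5 := C.rho_add x 1
    rw [Int.cast_one, one_mul] at h5
    rw [h5] at h4
    have h6 : (C.rho x : ℂ) ≠ 0 := by exact_mod_cast (C.rho_pos x).ne'
    refine (mul_eq_zero.1 (?_ : (C.rho x : ℂ) * _ = 0)).resolve_left h6
    rw [← h4]
    ring
  have h7 := eq_zero_on_Ioo_of_ae (u := fun x => p (x + C.L) + -C.multiplier k * p x)
    (by fun_prop) h3 0 ⟨by norm_num, by norm_num⟩
  simp only [zero_add] at h7
  linear_combination h7

/-- The operator `𝓛(k)` as a two-point boundary value problem on the unit cell. -/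
theorem helmholtzRel_iff (k : ℂ) (f g : C.Cell) : C.HelmholtzRel k f g ↔
    ∃ u p : ℝ →ᵇ ℂ, f = C.toCell u ∧
      (∀ x, u x = u 0 + C.primRho (C.toCell p) x) ∧ (∀ x, p x = p 0 - C.primKappa g x) ∧
      u C.L = C.multiplier k * u 0 ∧ p C.L = C.multiplier k * p 0 := by
  constructor
  · rintro ⟨u, p, q, hk, hu, hp, hf, hg⟩
    refine ⟨C.clampFunction u hu.continuous, C.clampFunction p hp.continuous,
      toCell_eq_of_ae (hf.trans (clampFunction_ae_eq u _).symm), fun x => ?_, fun x => ?_, ?_, ?_⟩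
    · change u (C.clamp x) = u (C.clamp 0) + _
      rw [primRho, C.weightedPrimitive_eq_of_ae _ _ _
        ((C.coeFn_toCell _).trans (clampFunction_ae_eq p _)), clamp_zero, ← hu.2]
      ring
    · change p (C.clamp x) = p (C.clamp 0) - _
      rw [primKappa, C.weightedPrimitive_eq_of_ae _ _ _ hg, clamp_zero]
      have h1 : ∀ s, (C.compliance s : ℂ) * -((C.kappa s : ℂ) * q s) = - q s := by
        intro s
        linear_combination (-q s) * C.kappa_mul_compliance s
      simp only [h1]
      rw [intervalIntegral.integral_neg, ← hp.2]
      ring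
    · change u (C.clamp C.L) = C.multiplier k * u (C.clamp 0)
      rw [clamp_L, clamp_zero]
      have := hk 1 0
      rw [← multiplier_zpow] at this
      simpa using this
    · change p (C.clamp C.L) = C.multiplier k * p (C.clamp 0)
      rw [clamp_L, clamp_zero]
      exact flux_quasiperiodic hk hu hp.continuous
  · rintro ⟨u, p, rfl, hu, hp, huL, hpL⟩
    set μ := C.multiplier k with hμ
    have hμ0 : μ ≠ 0 := multiplier_ne_zero k
    -- Forced by `g = -κ q`.
    set q : ℝ → ℂ := fun x => -((C.compliance x : ℂ) * g x) with hq
    refine ⟨C.extend μ u, C.extend μ p, C.extend μ q, fun m x => ?_, ?_, ?_, ?_, ?_⟩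
    · rw [extend_add hμ0, hμ, multiplier_zpow]
    · refine isWeakDeriv_of_quasiperiodic C.L_pos (μ := μ) (extend_add hμ0 _) (fun n x => ?_)
        fun x hx => ?_
      · rw [extend_add hμ0, rho_add]
        ring
      · have hc := C.clamp_of_mem hx.1 hx.2
        have hae : C.toCell p =ᵐ[C.cellMeasure] C.extend μ p :=
          (C.coeFn_toCell p).trans (extend_ae_eq μ p).symm
        constructor
        · have h1 := C.intervalIntegrable_weight_mul C.measurable_rho C.abs_rho_le (C.toCell p) 0 x
          rw [clamp_zero, hc] at h1
          refine h1.congr_ae ?_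
          rw [uIoc_of_le hx.1]
          filter_upwards [ae_restrict_of_ae_restrict_of_subset (Ioc_subset_Ioc_right hx.2) hae]
            with s hs
          rw [hs]
        · rw [extend_of_mem_Icc hμ0 huL hx, extend_of_mem_Icc hμ0 huL ⟨le_rfl, C.L_pos.le⟩, hu x,
            primRho, C.weightedPrimitive_eq_of_ae _ _ _ hae, hc]
          ring
    · refine isWeakDeriv_of_quasiperiodic C.L_pos (μ := μ) (extend_add hμ0 _) (extend_add hμ0 _)
        fun x hx => ?_
      have hc := C.clamp_of_mem hx.1 hx.2
      have hae : ∀ᵐ s ∂volume.restrict (Ioc 0 x), C.extend μ q s = q s :=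
        ae_restrict_of_ae_restrict_of_subset (Ioc_subset_Ioc_right hx.2) (extend_ae_eq μ q)
      constructor
      · have h1 := C.intervalIntegrable_weight_mul C.measurable_compliance C.abs_compliance_le g 0 x
        rw [clamp_zero, hc] at h1
        refine h1.neg.congr_ae ?_
        rw [uIoc_of_le hx.1]
        filter_upwards [hae] with s hs
        rw [hs]
        rfl
      · rw [extend_of_mem_Icc hμ0 hpL hx, extend_of_mem_Icc hμ0 hpL ⟨le_rfl, C.L_pos.le⟩, hp x,
          primKappa, C.weightedPrimitive_apply, hc]
        have h2 : ∫ s in (0 : ℝ)..x, C.extend μ q s = ∫ s in (0 : ℝ)..x, q s := by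
          refine intervalIntegral.integral_congr_ae_restrict ?_
          rw [uIoc_of_le hx.1]
          exact hae
        rw [h2, hq, intervalIntegral.integral_neg]
        ring
    · exact (C.coeFn_toCell u).trans (extend_ae_eq μ u).symm
    · filter_upwards [extend_ae_eq (C := C) μ q] with x hx
      rw [hx]
      linear_combination (-g x) * C.kappa_mul_compliance x

end ResonatorChain

/-! ### Constancy of the Wronskian -/

theorem IsWeakDeriv.lipschitzWith {u v : ℝ → ℂ} (h : IsWeakDeriv u v) {M : NNReal}
    (hM : ∀ x, ‖v x‖ ≤ M) : LipschitzWith M u := by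
  refine LipschitzWith.of_dist_le_mul fun x y => ?_
  rw [dist_comm, dist_eq_norm, h.2 x y, dist_comm, Real.dist_eq]
  exact intervalIntegral.norm_integral_le_of_norm_le_const fun s _ => hM s

theorem IsWeakDeriv.ae_hasDerivAt {u v : ℝ → ℂ} (h : IsWeakDeriv u v) :
    ∀ᵐ x, HasDerivAt u (v x) x := by
  have h2 : u = fun b => u 0 + ∫ x in (0 : ℝ)..b, v x := by
    funext b
    rw [← h.2 0 b]
    ring
  filter_upwards [LocallyIntegrable.ae_hasDerivAt_integral h.1] with x hx
  rw [h2]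
  exact (hx 0).const_add _

theorem isWeakDeriv_primitive {v : ℝ → ℂ} (hv : ∀ x, IntervalIntegrable v volume 0 x) (c : ℂ) :
    IsWeakDeriv (fun x => c + ∫ s in (0 : ℝ)..x, v s) v :=
  isWeakDeriv_of_zero fun x => ⟨hv x, by simp⟩

/-- A product combination `u q - v p` of Lipschitz functions is constant on an interval if its
derivative vanishes almost everywhere there. -/
theorem wronskian_eq {u p v q u' p' v' q' : ℝ → ℂ} {M : NNReal} {L : ℝ} (hL : 0 ≤ L)
    (hu : IsWeakDeriv u u') (hp : IsWeakDeriv p p') (hv : IsWeakDeriv v v')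
    (hq : IsWeakDeriv q q') (hu' : ∀ x, ‖u' x‖ ≤ M) (hp' : ∀ x, ‖p' x‖ ≤ M)
    (hv' : ∀ x, ‖v' x‖ ≤ M) (hq' : ∀ x, ‖q' x‖ ≤ M)
    (h : ∀ x ∈ Icc 0 L, u' x * q x + u x * q' x - (v' x * p x + v x * p' x) = 0) :
    u L * q L - v L * p L = u 0 * q 0 - v 0 * p 0 := by
  have ac : ∀ {f f' : ℝ → ℂ}, IsWeakDeriv f f' → (∀ x, ‖f' x‖ ≤ M) →
      AbsolutelyContinuousOnInterval f 0 L := fun hf hf' =>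
    ((hf.lipschitzWith hf').lipschitzOnWith (s := uIcc 0 L)).absolutelyContinuousOnInterval
  have hW := ((ac hu hu').smul (ac hq hq')).sub ((ac hv hv').smul (ac hp hp'))
  obtain ⟨c, hc⟩ := hW.const_of_ae_hasDerivAt_zero (by
    filter_upwards [hu.ae_hasDerivAt, hp.ae_hasDerivAt, hv.ae_hasDerivAt, hq.ae_hasDerivAt]
      with x h1 h2 h3 h4 hx
    rw [uIcc_of_le hL] at hx
    rw [← h x hx]
    exact (h1.mul h4).sub (h3.mul h2))
  have h1 := (hc L right_mem_uIcc).trans (hc 0 left_mem_uIcc).symm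
  simpa using h1

/-! ### Solutions with given Cauchy data and the transfer matrix -/

namespace ResonatorChain

variable (C : ResonatorChain)

/-- The constant function `1`. -/
noncomputable def oneFunction : ℝ →ᵇ ℂ := BoundedContinuousFunction.const ℝ 1

theorem oneFunction_apply (x : ℝ) : oneFunction x = 1 := rfl

/-- The solution `u` of the inhomogeneous equation `-κ ((1 / ρ) u')' - z u = h` on the unit cell
with `u (0) = a` and `(1 / ρ) u' (0) = b`, as a function of `(a, b, h)`. -/
noncomputable def solution (z : ℂ) : ℂ × ℂ × C.Cell →L[ℂ] (ℝ →ᵇ ℂ) :=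
  C.solve z ∘L (ContinuousLinearMap.coprod (ContinuousLinearMap.toSpanSingleton ℂ oneFunction)
    (ContinuousLinearMap.coprod
      (ContinuousLinearMap.toSpanSingleton ℂ (C.primRho (C.toCell oneFunction)))
      (-(C.primRho ∘L C.toCell ∘L C.primKappa))))

/-- The flux `(1 / ρ) u'` of the solution `u`. -/
noncomputable def flux (z : ℂ) : ℂ × ℂ × C.Cell →L[ℂ] (ℝ →ᵇ ℂ) :=
  ContinuousLinearMap.coprod 0 (ContinuousLinearMap.coprod
    (ContinuousLinearMap.toSpanSingleton ℂ oneFunction) (-C.primKappa)) -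
    z • (C.primKappa ∘L C.toCell ∘L C.solution z)

theorem solution_apply (z a b : ℂ) (h : C.Cell) : C.solution z (a, b, h) =
    C.solve z (a • oneFunction + (b • C.primRho (C.toCell oneFunction)
      - C.primRho (C.toCell (C.primKappa h)))) := by
  simp [solution, sub_eq_add_neg]

theorem flux_apply (z a b : ℂ) (h : C.Cell) : C.flux z (a, b, h) =
    b • oneFunction - C.primKappa h - z • C.primKappa (C.toCell (C.solution z (a, b, h))) := by
  simp [flux, sub_eq_add_neg]

/-- Eliminating `p` leaves one Volterra equation for `u`, which `solve` inverts. This is existence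
and uniqueness for the Cauchy problem in one statement. -/
theorem system_iff (z a b : ℂ) (h : C.Cell) (u p : ℝ →ᵇ ℂ) :
    (u = a • oneFunction + C.primRho (C.toCell p) ∧
      p = b • oneFunction - C.primKappa (h + z • C.toCell u)) ↔
    u = C.solution z (a, b, h) ∧ p = C.flux z (a, b, h) := by
  have key : ∀ u : ℝ →ᵇ ℂ, a • oneFunction +
      C.primRho (C.toCell (b • oneFunction - C.primKappa (h + z • C.toCell u))) =
      a • oneFunction + (b • C.primRho (C.toCell oneFunction)
      - C.primRho (C.toCell (C.primKappa h))) - z • C.volterra u := by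
    intro u
    rw [volterra_apply]
    simp only [map_sub, map_add, map_smul]
    abel
  constructor
  · rintro ⟨h1, h2⟩
    have h3 : C.solution z (a, b, h) = u := by
      rw [solution_apply, solve_eq_iff]
      rw [h2, key] at h1
      nth_rw 1 [h1]
      abel
    refine ⟨h3.symm, ?_⟩
    rw [flux_apply, h3, h2, map_add, map_smul]
    abel
  · rintro ⟨h1, h2⟩
    have h4 : p = b • oneFunction - C.primKappa (h + z • C.toCell u) := by
      rw [h2, flux_apply, ← h1, map_add, map_smul]
      abel
    refine ⟨?_, h4⟩
    rw [h4, key]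
    rw [solution_apply, eq_comm, solve_eq_iff] at h1
    rw [← h1]
    abel

theorem solution_eq (z a b : ℂ) (h : C.Cell) : C.solution z (a, b, h) =
    a • oneFunction + C.primRho (C.toCell (C.flux z (a, b, h))) :=
  ((C.system_iff z a b h _ _).2 ⟨rfl, rfl⟩).1

theorem flux_eq (z a b : ℂ) (h : C.Cell) : C.flux z (a, b, h) =
    b • oneFunction - C.primKappa (h + z • C.toCell (C.solution z (a, b, h))) :=
  ((C.system_iff z a b h _ _).2 ⟨rfl, rfl⟩).2

theorem primRho_zero (f : C.Cell) : C.primRho f 0 = 0 := C.weightedPrimitive_zero _ _ f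

theorem primKappa_zero (f : C.Cell) : C.primKappa f 0 = 0 := C.weightedPrimitive_zero _ _ f

theorem solution_zero (z a b : ℂ) (h : C.Cell) : C.solution z (a, b, h) 0 = a := by
  rw [solution_eq]
  simp [primRho_zero, oneFunction_apply]

theorem flux_zero (z a b : ℂ) (h : C.Cell) : C.flux z (a, b, h) 0 = b := by
  rw [flux_eq]
  simp [primKappa_zero, oneFunction_apply]

/-- The right-hand side `h + z • f` encodes `(𝓛(k) - z) f = h`. The resolvent problem thus becomes
two linear equations for the Cauchy data `(a, b)`. -/
theorem helmholtzRel_iff_solution (k z : ℂ) (f h : C.Cell) : C.HelmholtzRel k f (h + z • f) ↔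
    ∃ a b : ℂ, f = C.toCell (C.solution z (a, b, h)) ∧
      C.solution z (a, b, h) C.L = C.multiplier k * a ∧
      C.flux z (a, b, h) C.L = C.multiplier k * b := by
  rw [helmholtzRel_iff]
  constructor
  · rintro ⟨u, p, rfl, hu, hp, huL, hpL⟩
    have h1 := (C.system_iff z (u 0) (p 0) h u p).1 ⟨by
      ext x
      simpa [oneFunction_apply] using hu x, by
      ext x
      simpa [oneFunction_apply] using hp x⟩
    refine ⟨u 0, p 0, ?_, ?_, ?_⟩
    · rw [← h1.1]
    · rw [← h1.1, huL]
    · rw [← h1.2, hpL]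
  · rintro ⟨a, b, rfl, huL, hpL⟩
    refine ⟨C.solution z (a, b, h), C.flux z (a, b, h), rfl, fun x => ?_, fun x => ?_, ?_, ?_⟩
    · rw [solution_zero]
      nth_rw 1 [solution_eq]
      simp [oneFunction_apply]
    · rw [flux_zero]
      nth_rw 1 [flux_eq]
      simp [oneFunction_apply]
    · rw [solution_zero, huL]
    · rw [flux_zero, hpL]

theorem primRho_one_ne_zero : C.primRho (C.toCell oneFunction) C.L ≠ 0 := by
  rw [primRho, weightedPrimitive_toCell_apply, clamp_L]
  simp only [oneFunction_apply, mul_one]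
  rw [intervalIntegral.integral_ofReal]
  have h1 : IntervalIntegrable C.rho volume 0 C.L :=
    intervalIntegrable_const.mono_fun' (g := fun _ => C.ρ₀ + C.ρ₁)
      C.measurable_rho.aestronglyMeasurable (Filter.Eventually.of_forall C.abs_rho_le)
  exact_mod_cast (intervalIntegral.intervalIntegral_pos_of_pos_on h1
    (fun x _ => C.rho_pos x) C.L_pos).ne'

/-- Ensures that nonzero Cauchy data give a nonzero element of `L²`. If `u` vanishes almost
everywhere it vanishes on `[0, L]`, so `a = 0`; the flux is then the constant `b`, and `0 = u(L) = b
∫ ρ` forces `b = 0`. -/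
theorem eq_zero_of_toCell_solution_eq_zero {z a b : ℂ}
    (h : C.toCell (C.solution z (a, b, 0)) = 0) : a = 0 ∧ b = 0 := by
  have e : C.cellMeasure = volume.restrict (Ioo 0 C.L) :=
    (Measure.restrict_congr_set Ioo_ae_eq_Ioc).symm
  set u := C.solution z (a, b, 0) with hu
  have hflux : C.flux z (a, b, 0) = b • oneFunction := by
    rw [flux_eq, ← hu, h]
    simp
  have hae : ∀ᵐ x, x ∈ Ioo 0 C.L → u x = 0 := by
    rw [← ae_restrict_iff' measurableSet_Ioo, ← e]
    filter_upwards [C.coeFn_toCell u, Lp.coeFn_zero ℂ 2 C.cellMeasure] with x h1 h2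
    rw [← h1, h, h2]
    rfl
  have hIoo : EqOn u 0 (Ioo 0 C.L) := eq_zero_on_Ioo_of_ae u.continuous hae
  have hIcc : EqOn u 0 (Icc 0 C.L) := by
    have := hIoo.closure u.continuous continuous_zero
    rwa [closure_Ioo C.L_pos.ne] at this
  have ha : a = 0 := by
    have h0 := hIcc ⟨le_rfl, C.L_pos.le⟩
    rwa [hu, solution_zero] at h0
  refine ⟨ha, ?_⟩
  have hL := hIcc ⟨C.L_pos.le, le_rfl⟩
  rw [hu, solution_eq, hflux, ha, map_smul, map_smul] at hL
  simpa [C.primRho_one_ne_zero] using hL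

/-- An entry of the transfer matrix over the unit cell, which maps `(u, u' / ρ)` at `0` to its value
at `L`. -/
noncomputable def t₁₁ (z : ℂ) : ℂ := C.solution z (1, 0, 0) C.L

/-- An entry of the transfer matrix over the unit cell. -/
noncomputable def t₁₂ (z : ℂ) : ℂ := C.solution z (0, 1, 0) C.L

/-- An entry of the transfer matrix over the unit cell. -/
noncomputable def t₂₁ (z : ℂ) : ℂ := C.flux z (1, 0, 0) C.L

/-- An entry of the transfer matrix over the unit cell. -/
noncomputable def t₂₂ (z : ℂ) : ℂ := C.flux z (0, 1, 0) C.L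

theorem decompose (a b : ℂ) (h : C.Cell) :
    ((a, b, h) : ℂ × ℂ × C.Cell) = a • (1, 0, 0) + b • (0, 1, 0) + (0, 0, h) := by
  simp

theorem solution_L (z a b : ℂ) (h : C.Cell) : C.solution z (a, b, h) C.L =
    a * C.t₁₁ z + b * C.t₁₂ z + C.solution z (0, 0, h) C.L := by
  rw [decompose, map_add, map_add, map_smul, map_smul]
  rfl

theorem flux_L (z a b : ℂ) (h : C.Cell) : C.flux z (a, b, h) C.L =
    a * C.t₂₁ z + b * C.t₂₂ z + C.flux z (0, 0, h) C.L := by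
  rw [decompose, map_add, map_add, map_smul, map_smul]
  rfl

theorem intervalIntegrable_mul_bounded {w : ℝ → ℝ} {M : ℝ} (hw : Measurable w)
    (hM : ∀ x, |w x| ≤ M) (u : ℝ →ᵇ ℂ) (a b : ℝ) :
    IntervalIntegrable (fun s => (w s : ℂ) * u s) volume a b := by
  rw [intervalIntegrable_iff]
  exact integrable_weight_mul hw hM
    (intervalIntegrable_iff.1 (u.continuous.intervalIntegrable a b))

/-- The transfer matrix has determinant one. -/
theorem transfer_det (z : ℂ) : C.t₁₁ z * C.t₂₂ z - C.t₁₂ z * C.t₂₁ z = 1 := by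
  set M₁ := C.ρ₀ + C.ρ₁
  set M₂ := C.κ₀⁻¹ + ∑ i, (C.κ i)⁻¹
  have hM₁ : 0 ≤ M₁ := (abs_nonneg _).trans (C.abs_rho_le 0)
  have hM₂ : 0 ≤ M₂ := (abs_nonneg _).trans (C.abs_compliance_le 0)
  set s := fun a b : ℂ => C.solution z (a, b, 0) with hs
  set f := fun a b : ℂ => C.flux z (a, b, 0) with hf
  set s' := fun (a b : ℂ) (x : ℝ) => (C.rho x : ℂ) * f a b x with hs'
  set f' := fun (a b : ℂ) (x : ℝ) => -z * ((C.compliance x : ℂ) * s a b x) with hf'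
  -- Outside the cell the clamped solutions are constant and need not satisfy the equation. Genuine
  -- primitives on `ℝ` replace them and agree with them on `[0, L]`.
  have ws : ∀ a b, IsWeakDeriv (fun x => a + ∫ y in (0 : ℝ)..x, s' a b y) (s' a b) := fun a b =>
    isWeakDeriv_primitive
      (intervalIntegrable_mul_bounded C.measurable_rho C.abs_rho_le (f a b) 0) a
  have wf : ∀ a b, IsWeakDeriv (fun x => b + ∫ y in (0 : ℝ)..x, f' a b y) (f' a b) := fun a b =>
    isWeakDeriv_primitive (fun x => (intervalIntegrable_mul_bounded C.measurable_compliance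
      C.abs_compliance_le (s a b) 0 x).const_mul (-z)) b
  have es : ∀ a b, ∀ x ∈ Icc 0 C.L, a + ∫ y in (0 : ℝ)..x, s' a b y = s a b x := by
    intro a b x hx
    simp only [hs]
    rw [solution_eq, BoundedContinuousFunction.add_apply, primRho, weightedPrimitive_toCell_apply,
      C.clamp_of_mem hx.1 hx.2]
    simp [oneFunction_apply, hs', hf]
  have ef : ∀ a b, ∀ x ∈ Icc 0 C.L, b + ∫ y in (0 : ℝ)..x, f' a b y = f a b x := by
    intro a b x hx
    simp only [hf]
    rw [flux_eq, zero_add, map_smul, BoundedContinuousFunction.sub_apply,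
      BoundedContinuousFunction.smul_apply, BoundedContinuousFunction.smul_apply, primKappa,
      weightedPrimitive_toCell_apply, C.clamp_of_mem hx.1 hx.2]
    simp [oneFunction_apply, hf', hs]
    ring
  set K := ‖s 1 0‖ + ‖s 0 1‖ + ‖f 1 0‖ + ‖f 0 1‖
  have n1 := norm_nonneg (s 1 0)
  have n2 := norm_nonneg (s 0 1)
  have n3 := norm_nonneg (f 1 0)
  have n4 := norm_nonneg (f 0 1)
  have bs : ∀ a b, ‖f a b‖ ≤ K → ∀ x, ‖s' a b x‖ ≤ M₁ * K + ‖z‖ * (M₂ * K) := by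
    intro a b h x
    simp only [hs', norm_mul, Complex.norm_real, Real.norm_eq_abs]
    have h1 : |C.rho x| * ‖f a b x‖ ≤ M₁ * K :=
      mul_le_mul (C.abs_rho_le x) (((f a b).norm_coe_le_norm x).trans h) (norm_nonneg _) hM₁
    have h2 : 0 ≤ ‖z‖ * (M₂ * K) := by positivity
    linarith
  have bf : ∀ a b, ‖s a b‖ ≤ K → ∀ x, ‖f' a b x‖ ≤ M₁ * K + ‖z‖ * (M₂ * K) := by
    intro a b h x
    simp only [hf', norm_mul, norm_neg, Complex.norm_real, Real.norm_eq_abs]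
    have h1 : |C.compliance x| * ‖s a b x‖ ≤ M₂ * K :=
      mul_le_mul (C.abs_compliance_le x) (((s a b).norm_coe_le_norm x).trans h) (norm_nonneg _) hM₂
    have h2 := mul_le_mul_of_nonneg_left h1 (norm_nonneg z)
    have h3 : 0 ≤ M₁ * K := by positivity
    linarith
  have hW := wronskian_eq (M := ⟨M₁ * K + ‖z‖ * (M₂ * K), by positivity⟩) C.L_pos.le
    (ws 1 0) (wf 1 0) (ws 0 1) (wf 0 1)
    (bs _ _ (by linarith)) (bf _ _ (by linarith)) (bs _ _ (by linarith)) (bf _ _ (by linarith))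
    (fun x hx => by
      simp only [es _ _ x hx, ef _ _ x hx]
      simp only [hs', hf']
      ring)
  have hLmem : C.L ∈ Icc 0 C.L := ⟨C.L_pos.le, le_rfl⟩
  simp only [es _ _ _ hLmem, ef _ _ _ hLmem, intervalIntegral.integral_same] at hW
  have h1 : s 1 0 C.L * f 0 1 C.L - s 0 1 C.L * f 1 0 C.L = 1 := by simpa using hW
  exact h1

/-! ### The discriminant determines the spectrum -/

/-- The discriminant, the trace of the transfer matrix. -/
noncomputable def discriminant (z : ℂ) : ℂ := C.t₁₁ z + C.t₂₂ z

theorem charpoly_eq (z μ : ℂ) : (C.t₁₁ z - μ) * (C.t₂₂ z - μ) - C.t₁₂ z * C.t₂₁ z =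
    1 - C.discriminant z * μ + μ ^ 2 := by
  rw [discriminant]
  linear_combination C.transfer_det z

/-- A kernel vector of `T - μ` is the Cauchy data of an eigenfunction, which a left inverse of `𝓛(k)
- z` would send to zero. -/
theorem mem_unboundedSpectrum_of_det_eq_zero {k z : ℂ}
    (h : (C.t₁₁ z - C.multiplier k) * (C.t₂₂ z - C.multiplier k) - C.t₁₂ z * C.t₂₁ z = 0) :
    z ∈ unboundedSpectrum (C.operator k) := by
  set μ := C.multiplier k with hμ
  obtain ⟨a, b, hab, h1, h2⟩ : ∃ a b : ℂ, (a ≠ 0 ∨ b ≠ 0) ∧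
      a * (C.t₁₁ z - μ) + b * C.t₁₂ z = 0 ∧ a * C.t₂₁ z + b * (C.t₂₂ z - μ) = 0 := by
    obtain ⟨v, hv, hv0⟩ := Matrix.exists_mulVec_eq_zero_iff.2
      (show (!![C.t₁₁ z - μ, C.t₁₂ z; C.t₂₁ z, C.t₂₂ z - μ]).det = 0 by
        rw [Matrix.det_fin_two_of, h])
    refine ⟨v 0, v 1, ?_, ?_, ?_⟩
    · by_contra! hc
      exact hv (by ext i; fin_cases i <;> simp [hc.1, hc.2])
    · have := congrFun hv0 0
      simp [Matrix.mulVec, dotProduct] at this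
      linear_combination this
    · have := congrFun hv0 1
      simp [Matrix.mulVec, dotProduct] at this
      linear_combination this
  rintro ⟨R, -, hR⟩
  have hrel : C.HelmholtzRel k (C.toCell (C.solution z (a, b, 0)))
      (0 + z • C.toCell (C.solution z (a, b, 0))) := by
    refine (C.helmholtzRel_iff_solution k z _ 0).2 ⟨a, b, rfl, ?_, ?_⟩
    · rw [solution_L, show ((0, 0, 0) : ℂ × ℂ × C.Cell) = 0 from rfl, map_zero,
        BoundedContinuousFunction.coe_zero, Pi.zero_apply]
      linear_combination h1
    · rw [flux_L, show ((0, 0, 0) : ℂ × ℂ × C.Cell) = 0 from rfl, map_zero,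
        BoundedContinuousFunction.coe_zero, Pi.zero_apply]
      linear_combination h2
  obtain ⟨w, hw1, hw2⟩ := (LinearPMap.mem_graph_iff _).1 ((C.mem_graph_operator k _ _).2 hrel)
  have h3 := hR w
  rw [hw2, hw1] at h3
  simp only [zero_add, sub_self, map_zero] at h3
  have h4 := C.eq_zero_of_toCell_solution_eq_zero h3.symm
  exact hab.elim (fun h => h h4.1) fun h => h h4.2

/-- The data must solve `(T - μ)(a, b) = -(α h, β h)`, where `α h` and `β h` are the values at `L`
of the solution with zero data and its flux. Cramer's rule gives `a` and `b` as bounded functionals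
of `h`, hence a bounded resolvent. -/
theorem notMem_unboundedSpectrum_of_det_ne_zero {k z : ℂ}
    (h : (C.t₁₁ z - C.multiplier k) * (C.t₂₂ z - C.multiplier k) - C.t₁₂ z * C.t₂₁ z ≠ 0) :
    z ∉ unboundedSpectrum (C.operator k) := by
  set μ := C.multiplier k with hμ
  set d := (C.t₁₁ z - μ) * (C.t₂₂ z - μ) - C.t₁₂ z * C.t₂₁ z with hd
  set inc : C.Cell →L[ℂ] ℂ × ℂ × C.Cell := ContinuousLinearMap.inr ℂ ℂ (ℂ × C.Cell) ∘L
    ContinuousLinearMap.inr ℂ ℂ C.Cell with hinc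
  set α : C.Cell →L[ℂ] ℂ := BoundedContinuousFunction.evalCLM ℂ C.L ∘L C.solution z ∘L inc with hα
  set β : C.Cell →L[ℂ] ℂ := BoundedContinuousFunction.evalCLM ℂ C.L ∘L C.flux z ∘L inc with hβ
  have hαh : ∀ h, C.solution z (0, 0, h) C.L = α h := fun h => rfl
  have hβh : ∀ h, C.flux z (0, 0, h) C.L = β h := fun h => rfl
  set a : C.Cell →L[ℂ] ℂ := (-d⁻¹) • ((C.t₂₂ z - μ) • α - C.t₁₂ z • β) with ha
  set b : C.Cell →L[ℂ] ℂ := (-d⁻¹) • ((C.t₁₁ z - μ) • β - C.t₂₁ z • α) with hb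
  have hah : ∀ h, a h = -d⁻¹ * ((C.t₂₂ z - μ) * α h - C.t₁₂ z * β h) := fun h => rfl
  have hbh : ∀ h, b h = -d⁻¹ * ((C.t₁₁ z - μ) * β h - C.t₂₁ z * α h) := fun h => rfl
  set R : C.Cell →L[ℂ] C.Cell :=
    C.toCell ∘L C.solution z ∘L a.prod (b.prod (ContinuousLinearMap.id ℂ C.Cell)) with hR
  have hRh : ∀ h, R h = C.toCell (C.solution z (a h, b h, h)) := fun h => rfl
  have hdd : d⁻¹ * d = 1 := inv_mul_cancel₀ h
  have hrel : ∀ h f, C.HelmholtzRel k f (h + z • f) ↔ f = R h := by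
    intro h f
    rw [helmholtzRel_iff_solution]
    constructor
    · rintro ⟨a', b', rfl, h1, h2⟩
      rw [solution_L, hαh] at h1
      rw [flux_L, hβh] at h2
      have e1 : a' = a h := by
        rw [hah]
        linear_combination (d⁻¹ * (C.t₂₂ z - μ)) * h1 - (d⁻¹ * C.t₁₂ z) * h2 - a' * hdd
      have e2 : b' = b h := by
        rw [hbh]
        linear_combination (d⁻¹ * (C.t₁₁ z - μ)) * h2 - (d⁻¹ * C.t₂₁ z) * h1 - b' * hdd
      rw [hRh, e1, e2]
    · rintro rfl
      refine ⟨a h, b h, hRh h, ?_, ?_⟩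
      · rw [solution_L, hαh, hah, hbh]
        linear_combination (- α h) * hdd
      · rw [flux_L, hβh, hah, hbh]
        linear_combination (- β h) * hdd
  rw [unboundedSpectrum, mem_ofPred_eq, not_not]
  refine ⟨R, fun f => ?_, fun w => ?_⟩
  · obtain ⟨w, hw1, hw2⟩ := (LinearPMap.mem_graph_iff _).1
      ((C.mem_graph_operator k _ _).2 ((hrel f _).2 rfl))
    refine ⟨w, hw1, ?_⟩
    rw [hw2, hw1]
    simp only
    abel
  · have h1 := (C.mem_graph_operator k _ _).1 ((C.operator k).mem_graph w)
    rw [eq_comm, ← hrel, sub_add_cancel]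
    exact h1

theorem mem_unboundedSpectrum_iff (k z : ℂ) : z ∈ unboundedSpectrum (C.operator k) ↔
    2 * Complex.cos (k * C.L) = C.discriminant z := by
  have h1 : z ∈ unboundedSpectrum (C.operator k) ↔
      1 - C.discriminant z * C.multiplier k + C.multiplier k ^ 2 = 0 := by
    rw [← charpoly_eq]
    exact ⟨fun h => by_contra fun h' => C.notMem_unboundedSpectrum_of_det_ne_zero h' h,
      C.mem_unboundedSpectrum_of_det_eq_zero⟩
  have hμ := multiplier_ne_zero (C := C) k
  have h2 : 2 * Complex.cos (k * C.L) = C.multiplier k + (C.multiplier k)⁻¹ := by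
    rw [Complex.two_cos, multiplier, ← Complex.exp_neg]
    ring_nf
  rw [h1, h2]
  constructor
  · intro h
    field_simp
    linear_combination h
  · intro h
    rw [← h]
    field_simp
    ring

end ResonatorChain

/-! ### Connected components under homeomorphisms of subsets -/

theorem image_connectedComponentIn_of_invOn {X Y : Type*} [TopologicalSpace X]
    [TopologicalSpace Y] {S : Set X} {T : Set Y} {f : X → Y} {g : Y → X} (hf : ContinuousOn f S)
    (hg : ContinuousOn g T) (hfS : MapsTo f S T) (hgT : MapsTo g T S) (h : InvOn g f S T)
    {x : X} (hx : x ∈ S) :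
    f '' connectedComponentIn S x = connectedComponentIn T (f x) := by
  have hsub := connectedComponentIn_subset S x
  have hsub' := connectedComponentIn_subset T (f x)
  refine Subset.antisymm ?_ fun y hy => ?_
  · exact (isPreconnected_connectedComponentIn.image f (hf.mono hsub)).subset_connectedComponentIn
      (mem_image_of_mem f (mem_connectedComponentIn hx)) ((hfS.mono_left hsub).image_subset)
  · have h1 : g '' connectedComponentIn T (f x) ⊆ connectedComponentIn S x := by
      refine (isPreconnected_connectedComponentIn.image g
        (hg.mono hsub')).subset_connectedComponentIn ?_ ((hgT.mono_left hsub').image_subset)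
      exact ⟨f x, mem_connectedComponentIn (hfS hx), h.1 hx⟩
    exact ⟨g y, h1 (mem_image_of_mem g hy), h.2 (hsub' hy)⟩

/-- A homeomorphism between two sets induces a bijection of their connected components. -/
theorem bijOn_componentsOf {X Y : Type*} [TopologicalSpace X]
    [TopologicalSpace Y] {S : Set X} {T : Set Y} {f : X → Y} {g : Y → X} (hf : ContinuousOn f S)
    (hg : ContinuousOn g T) (hfS : MapsTo f S T) (hgT : MapsTo g T S) (h : InvOn g f S T) :
    BijOn (fun K => f '' K) (componentsOf S) (componentsOf T) := by
  refine ⟨?_, ?_, ?_⟩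
  · rintro _ ⟨x, hx, rfl⟩
    exact ⟨f x, hfS hx, image_connectedComponentIn_of_invOn hf hg hfS hgT h hx⟩
  · rintro _ ⟨x, hx, rfl⟩ _ ⟨y, hy, rfl⟩ hxy
    exact (h.1.injOn.image_eq_image_iff (connectedComponentIn_subset S x)
      (connectedComponentIn_subset S y)).1 hxy
  · rintro _ ⟨y, hy, rfl⟩
    refine ⟨_, ⟨g y, hgT hy, rfl⟩, ?_⟩
    change f '' _ = _
    rw [image_connectedComponentIn_of_invOn hf hg hfS hgT h (hgT hy), h.2 hy]

/-! ### Real spectral parameter: the discriminant and the resolvent set -/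

namespace ResonatorChain

variable (C : ResonatorChain)

theorem weightedPrimitive_star {w : ℝ → ℝ} {M : ℝ} (hw : Measurable w) (hM : ∀ x, |w x| ≤ M)
    (u : ℝ →ᵇ ℂ) : C.weightedPrimitive hw hM (C.toCell (star u)) =
      star (C.weightedPrimitive hw hM (C.toCell u)) := by
  ext x
  rw [BoundedContinuousFunction.star_apply, weightedPrimitive_toCell_apply,
    weightedPrimitive_toCell_apply, intervalIntegral.integral_of_le (C.clamp_nonneg x),
    intervalIntegral.integral_of_le (C.clamp_nonneg x)]
  have h := integral_conj (μ := volume.restrict (Ioc 0 (C.clamp x)))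
    (f := fun s => (w s : ℂ) * u s)
  refine (integral_congr_ae (Filter.Eventually.of_forall fun s => ?_)).trans h
  change (w s : ℂ) * (starRingEnd ℂ) (u s) = (starRingEnd ℂ) ((w s : ℂ) * u s)
  rw [map_mul, Complex.conj_ofReal]

theorem star_oneFunction : star oneFunction = oneFunction := by
  ext x
  simp [oneFunction_apply]

/-- For real `t` the system has real coefficients, so the conjugate pair solves it with conjugate
data; uniqueness identifies it. -/
theorem star_solution (t : ℝ) (a b : ℂ) :
    star (C.solution t (a, b, 0)) = C.solution t (star a, star b, 0) ∧
      star (C.flux t (a, b, 0)) = C.flux t (star a, star b, 0) := by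
  refine (C.system_iff t (star a) (star b) 0 _ _).1 ⟨?_, ?_⟩
  · nth_rw 1 [solution_eq]
    rw [star_add, star_smul, star_oneFunction, primRho, weightedPrimitive_star]
  · nth_rw 1 [flux_eq]
    rw [zero_add, zero_add, map_smul, map_smul, star_sub, star_smul, star_smul, star_oneFunction,
      primKappa, weightedPrimitive_star]
    simp

theorem conj_discriminant (t : ℝ) :
    (starRingEnd ℂ) (C.discriminant t) = C.discriminant t := by
  have h1 := DFunLike.congr_fun (C.star_solution t 1 0).1 C.L
  have h2 := DFunLike.congr_fun (C.star_solution t 0 1).2 C.L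
  rw [star_one, star_zero, BoundedContinuousFunction.star_apply] at h1 h2
  rw [discriminant, map_add]
  exact congrArg₂ (· + ·) h1 h2

/-- The discriminant at a real point of the spectral plane, as a real number. -/
noncomputable def realDiscriminant (t : ℝ) : ℝ := (C.discriminant t).re

theorem ofReal_realDiscriminant (t : ℝ) : (C.realDiscriminant t : ℂ) = C.discriminant t :=
  Complex.conj_eq_iff_re.1 (C.conj_discriminant t)

theorem continuous_solution (v : ℂ × ℂ × C.Cell) : Continuous fun z => C.solution z v := by
  unfold solution
  exact C.continuous_solve.clm_apply continuous_const

theorem continuous_flux (v : ℂ × ℂ × C.Cell) : Continuous fun z => C.flux z v := by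
  have h := (C.primKappa ∘L C.toCell).continuous.comp (C.continuous_solution v)
  exact continuous_const.sub (continuous_id.smul h)

theorem continuous_realDiscriminant : Continuous C.realDiscriminant := by
  have h1 := (BoundedContinuousFunction.evalCLM ℂ C.L).continuous.comp
    (C.continuous_solution (1, 0, 0))
  have h2 := (BoundedContinuousFunction.evalCLM ℂ C.L).continuous.comp (C.continuous_flux (0, 1, 0))
  exact Complex.continuous_re.comp ((h1.add h2).comp Complex.continuous_ofReal)

theorem mem_blochSpectrum_iff (α β t : ℝ) : (t : ℂ) ∈ C.blochSpectrum α β ↔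
    2 * (Real.cos (α * C.L) * Real.cosh (β * C.L)) = C.realDiscriminant t ∧
      Real.sin (α * C.L) * Real.sinh (β * C.L) = 0 := by
  rw [blochSpectrum, mem_unboundedSpectrum_iff, ← ofReal_realDiscriminant,
    show ((α : ℂ) + Complex.I * β) * C.L = ((α * C.L : ℝ) : ℂ) + ((β * C.L : ℝ) : ℂ) * Complex.I by
      push_cast; ring, Complex.cos_add_mul_I, ← Complex.ofReal_cos, ← Complex.ofReal_sin,
    ← Complex.ofReal_cosh, ← Complex.ofReal_sinh]
  generalize Real.sin (α * C.L) = a, Real.sinh (β * C.L) = b, Real.cos (α * C.L) = c,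
    Real.cosh (β * C.L) = d
  rw [Complex.ext_iff]
  simp

theorem mem_resolventSet_iff (t : ℝ) : t ∈ C.resolventSet ↔ 2 < |C.realDiscriminant t| := by
  have hL := C.L_pos
  rw [resolventSet, mem_ofPred_eq, ← not_le, not_iff_not, spectrum]
  simp only [mem_iUnion, exists_prop, mem_blochSpectrum_iff, zero_mul, Real.cosh_zero,
    Real.sinh_zero, mul_zero, mul_one, and_true]
  constructor
  · rintro ⟨α, -, h⟩
    rw [← h, abs_mul, abs_two]
    linarith [Real.abs_cos_le_one (α * C.L)]
  · intro h
    obtain ⟨h1, h2⟩ := abs_le.1 h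
    -- The range `[0, π]` of `arccos` puts this `α` in the Brillouin zone.
    refine ⟨Real.arccos (C.realDiscriminant t / 2) / C.L, ⟨?_, ?_⟩, ?_⟩
    · have := div_pos Real.pi_pos hL
      have := div_nonneg (Real.arccos_nonneg (C.realDiscriminant t / 2)) hL.le
      linarith
    · exact div_le_div_of_nonneg_right (Real.arccos_le_pi _) hL.le
    · rw [div_mul_cancel₀ _ hL.ne', Real.cos_arccos (by linarith) (by linarith)]
      ring

/-! ### The complex band structure as a graph over the gaps -/

/-- The real part of the quasimomentum at a point of a band gap. -/
noncomputable def gapReal (t : ℝ) : ℝ :=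
  Real.pi / C.L * ((1 - C.realDiscriminant t / |C.realDiscriminant t|) / 2)

/-- The decay rate at a point of a band gap. -/
noncomputable def gapDecay (t : ℝ) : ℝ := Real.arcosh (|C.realDiscriminant t| / 2) / C.L

theorem gapReal_of_pos {t : ℝ} (h : 0 < C.realDiscriminant t) : C.gapReal t = 0 := by
  rw [gapReal, abs_of_pos h, div_self h.ne']
  simp

theorem gapReal_of_neg {t : ℝ} (h : C.realDiscriminant t < 0) :
    C.gapReal t = Real.pi / C.L := by
  rw [gapReal, abs_of_neg h, div_neg, div_self h.ne]
  norm_num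

/-- The complex band structure is the graph of a function on the resolvent set. -/
theorem mem_complexBandStructure_iff (α β t : ℝ) : (α, β, t) ∈ C.complexBandStructure ↔
    t ∈ C.resolventSet ∧ α = C.gapReal t ∧ β = C.gapDecay t := by
  have hL := C.L_pos
  have hπ := Real.pi_pos
  have hπL := div_pos hπ hL
  have hcancel : Real.pi / C.L * C.L = Real.pi := div_mul_cancel₀ _ hL.ne'
  rw [mem_resolventSet_iff]
  change α ∈ Ioc _ _ ∧ 0 < β ∧ (t : ℂ) ∈ C.blochSpectrum α β ↔ _
  rw [mem_blochSpectrum_iff]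
  constructor
  · rintro ⟨⟨hα1, hα2⟩, hβ, h1, h2⟩
    have hβL : 0 < β * C.L := mul_pos hβ hL
    have hs := (mul_eq_zero.1 h2).resolve_right (Real.sinh_pos_iff.2 hβL).ne'
    have hch : 1 < Real.cosh (β * C.L) := Real.one_lt_cosh.2 hβL.ne'
    have hdecay : |C.realDiscriminant t| = 2 * Real.cosh (β * C.L) → β = C.gapDecay t := by
      intro h
      rw [gapDecay, h, mul_div_cancel_left₀ _ two_ne_zero, Real.arcosh_cosh hβL.le,
        mul_div_cancel_right₀ _ hL.ne']
    obtain ⟨n, hn⟩ := Real.sin_eq_zero_iff.1 hs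
    -- The zone is open at `-π/L`, which excludes `n = -1`; otherwise negative `Δ` would have two
    -- preimages.
    have hn1 : (n : ℝ) < 2 ∧ (-1 : ℝ) < n := by
      have h3 : -Real.pi < α * C.L := by
        have := mul_lt_mul_of_pos_right hα1 hL
        rwa [neg_mul, hcancel] at this
      have h4 : α * C.L ≤ Real.pi := by
        have := mul_le_mul_of_nonneg_right hα2 hL.le
        rwa [hcancel] at this
      constructor <;> nlinarith
    have hn2 : n = 0 ∨ n = 1 := by
      have h3 : n < 2 := by exact_mod_cast hn1.1
      have h4 : -1 < n := by exact_mod_cast hn1.2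
      omega
    rcases hn2 with rfl | rfl
    · have hα : α = 0 := by
        rw [Int.cast_zero, zero_mul, eq_comm, mul_eq_zero] at hn
        exact hn.resolve_right hL.ne'
      rw [hα, zero_mul, Real.cos_zero, one_mul] at h1
      have hpos : 0 < C.realDiscriminant t := by linarith
      have habs := abs_of_pos hpos
      refine ⟨by linarith, ?_, hdecay (by linarith)⟩
      rw [hα, C.gapReal_of_pos hpos]
    · rw [Int.cast_one, one_mul] at hn
      rw [← hn, Real.cos_pi] at h1
      have hneg : C.realDiscriminant t < 0 := by linarith
      have habs := abs_of_neg hneg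
      refine ⟨by linarith, ?_, hdecay (by linarith)⟩
      rw [C.gapReal_of_neg hneg, eq_div_iff hL.ne', hn]
  · rintro ⟨h, rfl, rfl⟩
    have h1 : 1 < |C.realDiscriminant t| / 2 := by linarith
    have hdecay : C.gapDecay t * C.L = Real.arcosh (|C.realDiscriminant t| / 2) :=
      div_mul_cancel₀ _ hL.ne'
    rw [hdecay, Real.cosh_arcosh h1.le]
    have hβ : 0 < C.gapDecay t := div_pos (Real.arcosh_pos h1) hL
    rcases lt_or_gt_of_ne (show C.realDiscriminant t ≠ 0 by
      intro h0
      rw [h0, abs_zero] at h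
      linarith) with hneg | hpos
    · rw [C.gapReal_of_neg hneg, hcancel, Real.cos_pi, Real.sin_pi, abs_of_neg hneg]
      exact ⟨⟨by linarith, le_rfl⟩, hβ, by ring, zero_mul _⟩
    · rw [C.gapReal_of_pos hpos, zero_mul, Real.cos_zero, Real.sin_zero, abs_of_pos hpos]
      exact ⟨⟨by linarith, hπL.le⟩, hβ, by ring, zero_mul _⟩

/-- Writing the sign of `Δ` as `Δ / |Δ|` makes this a quotient with nonvanishing denominator, since
`|Δ| > 2` on the gaps. -/
theorem continuousOn_gapReal : ContinuousOn C.gapReal C.resolventSet := by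
  have h := C.continuous_realDiscriminant.continuousOn (s := C.resolventSet)
  refine continuousOn_const.mul ((continuousOn_const.sub (h.div h.abs fun t ht => ?_)).div_const 2)
  have := (C.mem_resolventSet_iff t).1 ht
  linarith

theorem continuousOn_gapDecay : ContinuousOn C.gapDecay C.resolventSet := by
  have h := C.continuous_realDiscriminant.continuousOn (s := C.resolventSet)
  refine (Real.continuousOn_arcosh.comp (h.abs.div_const 2) fun t ht => ?_).div_const C.L
  have := (C.mem_resolventSet_iff t).1 ht
  rw [mem_Ici]
  linarith

theorem resolventSet_eq_iUnion : C.resolventSet =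
    ⋃ k ∈ C.gapQuasimomenta, {t : ℝ | (t : ℂ) ∈ C.blochSpectrum k.1 k.2} := by
  have hL := C.L_pos
  have hcancel : Real.pi / C.L * C.L = Real.pi := div_mul_cancel₀ _ hL.ne'
  ext t
  simp only [mem_iUnion, exists_prop, mem_ofPred_eq]
  constructor
  · intro ht
    obtain ⟨-, hβ, h⟩ := (C.mem_complexBandStructure_iff _ _ t).2 ⟨ht, rfl, rfl⟩
    refine ⟨(C.gapReal t, C.gapDecay t), ⟨?_, hβ.ne'⟩, h⟩
    have h0 : C.realDiscriminant t ≠ 0 := by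
      intro h0
      rw [mem_resolventSet_iff, h0, abs_zero] at ht
      linarith
    rcases lt_or_gt_of_ne h0 with hneg | hpos
    · simp [C.gapReal_of_neg hneg]
    · simp [C.gapReal_of_pos hpos]
  · rintro ⟨⟨α, β⟩, ⟨hα, hβ⟩, h⟩
    rw [mem_blochSpectrum_iff] at h
    have hβL : β * C.L ≠ 0 := mul_ne_zero hβ hL.ne'
    have hch : 1 < Real.cosh (β * C.L) := Real.one_lt_cosh.2 hβL
    -- With `|cos(αL)| = 1` and `cosh(βL) > 1` for either sign of `β`, the spectral condition yields
    -- `|Δ| > 2`.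
    have hcos : |Real.cos (α * C.L)| = 1 := by
      rcases hα with rfl | rfl | rfl
      · simp [hcancel]
      · simp
      · simp [hcancel]
    rw [mem_resolventSet_iff, ← h.1, abs_mul, abs_mul, abs_two, hcos, one_mul,
      abs_of_pos (Real.cosh_pos _)]
    linarith

end ResonatorChain

/-! ### The main theorem -/

theorem mainTheorem1 (C : ResonatorChain) :
    C.resolventSet =
        (⋃ k ∈ C.gapQuasimomenta, {t : ℝ | (t : ℂ) ∈ C.blochSpectrum k.1 k.2}) ∧
      Set.BijOn (fun w : ℝ × ℝ × ℝ => w.2.2) C.complexBandStructure C.resolventSet ∧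
      Set.BijOn (fun K : Set (ℝ × ℝ × ℝ) => (fun w : ℝ × ℝ × ℝ => w.2.2) '' K)
        C.complexBands C.bandGaps := by
  have hmaps : MapsTo (fun w : ℝ × ℝ × ℝ => w.2.2) C.complexBandStructure C.resolventSet :=
    fun w hw => ((C.mem_complexBandStructure_iff w.1 w.2.1 w.2.2).1 hw).1
  have hmaps' : MapsTo (fun t => (C.gapReal t, C.gapDecay t, t)) C.resolventSet
      C.complexBandStructure :=
    fun t ht => (C.mem_complexBandStructure_iff _ _ t).2 ⟨ht, rfl, rfl⟩
  -- The continuous graph map inverts the projection, so the two bijections follow from one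
  -- homeomorphism.
  have hinv : InvOn (fun t => (C.gapReal t, C.gapDecay t, t)) (fun w : ℝ × ℝ × ℝ => w.2.2)
      C.complexBandStructure C.resolventSet := by
    refine ⟨fun w hw => ?_, fun t _ => rfl⟩
    obtain ⟨-, h1, h2⟩ := (C.mem_complexBandStructure_iff w.1 w.2.1 w.2.2).1 hw
    exact Prod.ext h1.symm (Prod.ext h2.symm rfl)
  refine ⟨C.resolventSet_eq_iUnion, hinv.bijOn hmaps hmaps', ?_⟩
  exact bijOn_componentsOf (by fun_prop)
    (C.continuousOn_gapReal.prodMk (C.continuousOn_gapDecay.prodMk continuousOn_id))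
    hmaps hmaps' hinv
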